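/- Let $M$ be a smooth, connected, finite-dimensional Riemannian manifold with distance $d$ that is uniquely geodesic: any two points are connected by exactly one geodesic, where a geodesic is a smooth constant-speed curve that is locally distance minimizing. Let $\mathrm{Exp}_x(v)$ be the endpoint $g(1)$ of the geodesic $g$ with $g(0)=x$, $g'(0)=v$, and let $\mathrm{Exp}_x^{-1}(y)\in T_xM$ be the unique vector $v$ with $\mathrm{Exp}_x(v)=y$. For $u,v,w\in M$ put $\mathsf{D}_u(v,w):=\|\mathrm{Exp}_u^{-1}(v)-\mathrm{Exp}_u^{-1}(w)\|_u$. Let $L>0$, $\mu\ge 0$, and let $f:M\to\mathbb{R}$ be differentiable, geodesically $L$-smooth and geodesically $\mu$-strongly convex, i.e. for all $x,y\in M$ $$f(x)+\langle\nabla f(x),\mathrm{Exp}_x^{-1}(y)\rangle_x+\tfrac{\mu}{2}d(x,y)^2\ \le\ f(y)\ \le\ f(x)+\langle\nabla f(x),\mathrm{Exp}_x^{-1}(y)\rangle_x+\tfrac{L}{2}d(x,y)^2 .$$ Let $x_*$ be a minimizer of $f$. Fix $t\ge 0$, points $x_t,y_t,z_t\in M$, numbers $A_t,B_t>0$ and $\gamma_{t+1}\in(0,2/L)$,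 and put $\Delta_\gamma:=\gamma_{t+1}(1-L\gamma_{t+1}/2)$. Suppose that $\xi_{t+1}\in[2\mu\Delta_\gamma,1)$ satisfies $$\frac{\xi_{t+1}(\xi_{t+1}-2\mu\Delta_\gamma)}{1-\xi_{t+1}}=\frac{4\Delta_\gamma}{\delta_{t+1}}\cdot\frac{B_t}{A_t}$$ for some $\delta_{t+1}>0$, and put $$A_{t+1}=\frac{A_t}{1-\xi_{t+1}},\quad B_{t+1}=\frac{\xi_{t+1}^2}{1-\xi_{t+1}}\cdot\frac{A_t}{4\Delta_\gamma},\quad \alpha_{t+1}=\frac{\xi_{t+1}-2\mu\Delta_\gamma}{1-2\mu\Delta_\gamma},\quad \beta_{t+1}=1-2\mu\Delta_\gamma\,\xi_{t+1}^{-1},\quad \eta_{t+1}=2\Delta_\gamma\,\xi_{t+1}^{-1}.$$ Let $x_{t+1},y_{t+1},z_{t+1}$ be generated by (the exponentials being defined) $$x_{t+1}=\mathrm{Exp}_{y_t}\bigl(\alpha_{t+1}\mathrm{Exp}_{y_t}^{-1}(z_t)\bigr),\qquad y_{t+1}=\mathrm{Exp}_{x_{t+1}}\bigl(-\gamma_{t+1}\nabla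 f(x_{t+1})\bigr),$$ $$z_{t+1}=\mathrm{Exp}_{x_{t+1}}\bigl(\beta_{t+1}\mathrm{Exp}_{x_{t+1}}^{-1}(z_t)-\eta_{t+1}\nabla f(x_{t+1})\bigr),$$ and assume that $\delta_{t+1}$ is a valid distortion rate at iteration $t+1$, i.e. $\mathsf{D}_{x_{t+1}}(z_t,x_*)^2\le\delta_{t+1}\,\mathsf{D}_{x_t}(z_t,x_*)^2$. Then the potential $\Psi_s:=A_s\,(f(y_s)-f(x_*))+B_s\,\mathsf{D}_{x_s}(z_s,x_*)^2$ satisfies $\Psi_{t+1}\le\Psi_t$; in other words, $$f(y_{t+1})-f(x_*)+\frac{\xi_{t+1}^2}{4\Delta_\gamma}\,\mathsf{D}_{x_{t+1}}(z_{t+1},x_*)^2\le(1-\xi_{t+1})\Bigl[f(y_t)-f(x_*)+\frac{B_t}{A_t}\,\mathsf{D}_{x_t}(z_t,x_*)^2\Bigr].$$ -/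

import Mathlib

open scoped Manifold ContDiff Bundle
open Set Bundle

noncomputable section

namespace RiemNesterov

section Geometry

/- `M` is a smooth connected Riemannian manifold without boundary, modelled on the finite-dimensional
space `E`, and its metric-space distance is the Riemannian distance. -/
variable {E : Type*} [NormedAddCommGroup E] [NormedSpace ℝ E]
  {M : Type*} [MetricSpace M] [ChartedSpace E M]

variable (E) in
/-- The velocity vector `γ'(t) ∈ T_{γ(t)} M` of a curve `γ : [0, 1] → M`, as a point of the tangent
bundle (at the end points of `[0, 1]` it is the one-sided derivative). -/
def velocity (γ : ℝ → M) (t : ℝ) : TangentBundle 𝓘(ℝ, E) M :=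
  ⟨γ t, mfderivWithin 𝓘(ℝ, ℝ) 𝓘(ℝ, E) γ (Icc (0 : ℝ) 1) t (1 : ℝ)⟩

variable [RiemannianBundle (fun x : M ↦ TangentSpace 𝓘(ℝ, E) x)]

variable (E) in
/-- `γ : [0, 1] → M` is a geodesic: a smooth curve of constant speed `c` which is locally distance
minimizing, i.e. the length `c * |s - s'|` of every short enough sub-arc is the distance between
its end points. Only the values of `γ` on `[0, 1]` matter. -/
structure IsGeodesic (γ : ℝ → M) : Prop where
  smooth : ContMDiffOn 𝓘(ℝ, ℝ) 𝓘(ℝ, E) ∞ γ (Icc (0 : ℝ) 1)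
  locally_minimizing : ∃ c : ℝ,
    (∀ t ∈ Icc (0 : ℝ) 1, ‖(velocity E γ t).2‖ = c) ∧
    ∀ t ∈ Icc (0 : ℝ) 1, ∃ ε > 0, ∀ s ∈ Icc (0 : ℝ) 1, ∀ s' ∈ Icc (0 : ℝ) 1,
      |s - t| < ε → |s' - t| < ε → dist (γ s) (γ s') = c * |s - s'|

variable (E M) in
/-- `M` is uniquely geodesic: any two points are connected by exactly one geodesic. -/
def IsUniquelyGeodesic : Prop :=
  ∀ x y : M, ∃ γ : ℝ → M, IsGeodesic E γ ∧ γ 0 = x ∧ γ 1 = y ∧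
    ∀ γ' : ℝ → M, IsGeodesic E γ' → γ' 0 = x → γ' 1 = y → EqOn γ' γ (Icc 0 1)

/-- `IsExp x v y` means that `Exp_x v` is defined and `Exp_x v = y`: there is a geodesic `g` with
`g(0) = x`, `g'(0) = v` and `g(1) = y`. -/
def IsExp (x : M) (v : TangentSpace 𝓘(ℝ, E) x) (y : M) : Prop :=
  ∃ g : ℝ → M, IsGeodesic E g ∧
    velocity E g 0 = (⟨x, v⟩ : TangentBundle 𝓘(ℝ, E) M) ∧ g 1 = y

variable (E) in
open Classical in
/-- The inverse exponential map: `expInv E x y = Exp_x⁻¹ y` is the vector `v ∈ T_x M` with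
`Exp_x v = y` (existing and unique when `M` is uniquely geodesic). -/
def expInv (x y : M) : TangentSpace 𝓘(ℝ, E) x :=
  if h : ∃ v : TangentSpace 𝓘(ℝ, E) x, IsExp x v y then h.choose else 0

variable (E) in
/-- The projected distance `‖Exp_u⁻¹ v - Exp_u⁻¹ w‖` between `v` and `w` relative to `u`. -/
def projDist (u v w : M) : ℝ :=
  ‖expInv E u v - expInv E u w‖

variable (E) in
/-- `δ` is a valid distortion rate from the base point `x` to the base point `x'`, for the point
`z` and the reference point `xs`. In an iteration, `x = x_{t-1}`, `x' = x_t` and `z = z_{t-1}`. -/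
def IsValidDistortionRate (x x' z xs : M) (δ : ℝ) : Prop :=
  projDist E x' z xs ^ 2 ≤ δ * projDist E x z xs ^ 2

variable [FiniteDimensional ℝ E]

variable (E) in
/-- The Riemannian gradient of `f` at `x`: the vector of `T_x M` representing the differential. -/
def grad (f : M → ℝ) (x : M) : TangentSpace 𝓘(ℝ, E) x :=
  haveI : FiniteDimensional ℝ (TangentSpace 𝓘(ℝ, E) x) := inferInstanceAs (FiniteDimensional ℝ E)
  haveI : CompleteSpace (TangentSpace 𝓘(ℝ, E) x) := FiniteDimensional.complete ℝ _
  (InnerProductSpace.toDual ℝ (TangentSpace 𝓘(ℝ, E) x)).symm (mvfderiv 𝓘(ℝ, E) f x)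

variable (E) in
/-- A differentiable function is geodesically `μ`-strongly convex. -/
structure IsGeodesicallyStronglyConvex (μ : ℝ) (f : M → ℝ) : Prop where
  differentiable : MDifferentiable 𝓘(ℝ, E) 𝓘(ℝ, ℝ) f
  lower_bound : ∀ x y : M,
    f x + inner ℝ (grad E f x) (expInv E x y) + μ / 2 * dist x y ^ 2 ≤ f y

variable (E) in
/-- A differentiable function is geodesically `L`-smooth. -/
structure IsGeodesicallySmooth (L : ℝ) (f : M → ℝ) : Prop where
  differentiable : MDifferentiable 𝓘(ℝ, E) 𝓘(ℝ, ℝ) f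
  upper_bound : ∀ x y : M,
    f y ≤ f x + inner ℝ (grad E f x) (expInv E x y) + L / 2 * dist x y ^ 2

variable (E) in
/-- One step `(y, z) ↦ (x', y', z')` of the Riemannian Nesterov iteration with parameters
`α, β, γ, η`. -/
structure IsNesterovStep (f : M → ℝ) (α β γ η : ℝ) (y z x' y' z' : M) : Prop where
  x_update : IsExp y (α • expInv E y z) x'
  y_update : IsExp x' (-(γ • grad E f x')) y'
  z_update : IsExp x' (β • expInv E x' z - η • grad E f x') z'

variable (E) in
/-- The potential `A (f(y) - f(x_*)) + B ‖Exp_x⁻¹ z - Exp_x⁻¹ x_*‖²`. -/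
def potential (f : M → ℝ) (xs : M) (A B : ℝ) (x y z : M) : ℝ :=
  A * (f y - f xs) + B * projDist E x z xs ^ 2

end Geometry

end RiemNesterov

end

namespace RiemNesterov

/-! ### Geodesics, sub-arcs and the exponential relation -/

section Curves

variable {E : Type*} [NormedAddCommGroup E] [NormedSpace ℝ E]
  {M : Type*} [MetricSpace M] [ChartedSpace E M]

/-! Everything happens in one tangent space, at `x = x_{t+1}`. Write `g` for the gradient there,
`a`, `b` for the inverse exponentials of `z_t` and `x_*`, and `κ = 2μΔ`. Three inequalities enter:
the gradient step lowers `f` by `Δ‖g‖²`; strong convexity bounds `f(x_*)` from below through `⟨g,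
b⟩` and `‖b‖²`; and convexity bounds `f(y_t)` from below through `⟨g, a⟩`, because `x` lies on the
geodesic from `y_t` to `z_t` and the two inverse exponentials at `x` are opposite multiples of one
vector. Expanding `ξ²‖βa - ηg - b‖² = ‖(ξ-κ)a - ξb - 2Δg‖²` and dividing by `4Δ`, the inner products
and `Δ‖g‖²` cancel against these. What remains, `‖(ξ-κ)a - ξb‖²`, is split by convexity of the
squared norm: the `‖b‖²` part is paid by strong convexity, the `‖a-b‖²` part by the distortion rate
and the equation for `ξ`. This is `potential_decrease`.

The geometric work comes from geodesics being only locally minimizing. (1) The distance is at most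
`‖Exp⁻¹‖`, which suits the smoothness bound but not strong convexity. The latter holds exactly on
short arcs and is propagated along the geodesic (`lower_bound_expInv`). (2) `IsExp` is a relation.
Its injectivity in the vector is unique geodesy, but placing `x` on the geodesic from `y_t` to `z_t`
needs it to be single valued (`IsExp.unique`). In a chart, a short geodesic minimizes energy, hence
solves the Euler-Lagrange equation, whose solutions are determined by initial data; a continuation
argument then covers `[0, 1]`. -/

lemma uniqueMDiffWithinAt_Icc {a b t : ℝ} (hab : a < b) (ht : t ∈ Icc a b) :
    UniqueMDiffWithinAt 𝓘(ℝ, ℝ) (Icc a b) t :=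
  (uniqueDiffOn_Icc hab t ht).uniqueMDiffWithinAt

variable (E) in
/-- The velocity vector of a curve, as an element of the tangent space. -/
noncomputable def velocityVector (γ : ℝ → M) (t : ℝ) : TangentSpace 𝓘(ℝ, E) (γ t) :=
  mfderivWithin 𝓘(ℝ, ℝ) 𝓘(ℝ, E) γ (Icc (0 : ℝ) 1) t (1 : ℝ)

lemma velocity_eq (γ : ℝ → M) (t : ℝ) :
    velocity E γ t = (⟨γ t, velocityVector E γ t⟩ : TangentBundle 𝓘(ℝ, E) M) := rfl

/-- The velocity only depends on the values on the unit interval. -/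
lemma velocity_congr {γ γ' : ℝ → M} (h : EqOn γ γ' (Icc 0 1)) {t : ℝ} (ht : t ∈ Icc (0 : ℝ) 1) :
    velocity E γ t = velocity E γ' t := by
  have h1 : mfderivWithin 𝓘(ℝ, ℝ) 𝓘(ℝ, E) γ (Icc (0 : ℝ) 1) t
      = mfderivWithin 𝓘(ℝ, ℝ) 𝓘(ℝ, E) γ' (Icc (0 : ℝ) 1) t := mfderivWithin_congr h (h ht)
  unfold velocity
  rw [h1]
  congr 1
  exact h ht

/-- Velocity of an affine reparametrisation. -/
lemma mfderivWithin_comp_affine {γ : ℝ → M}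
    (hγ : MDifferentiableOn 𝓘(ℝ, ℝ) 𝓘(ℝ, E) γ (Icc 0 1)) {a b : ℝ}
    (hab : ∀ u ∈ Icc (0 : ℝ) 1, a + u * b ∈ Icc (0 : ℝ) 1) {u : ℝ} (hu : u ∈ Icc (0 : ℝ) 1) :
    (mfderivWithin 𝓘(ℝ, ℝ) 𝓘(ℝ, E) (fun s : ℝ ↦ γ (a + s * b)) (Icc (0 : ℝ) 1) u (1 : ℝ)
      : TangentSpace 𝓘(ℝ, E) (γ (a + u * b))) =
      b • (mfderivWithin 𝓘(ℝ, ℝ) 𝓘(ℝ, E) γ (Icc (0 : ℝ) 1) (a + u * b) (1 : ℝ)) := by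
  have hd : HasDerivWithinAt (fun s : ℝ ↦ a + s * b) b (Icc 0 1) u := by
    simpa using (((hasDerivAt_id u).mul_const b).const_add a).hasDerivWithinAt
  have hm := hd.hasFDerivWithinAt.hasMFDerivWithinAt
  have hsub : Icc (0 : ℝ) 1 ⊆ (fun s : ℝ ↦ a + s * b) ⁻¹' Icc 0 1 := fun s hs ↦ hab s hs
  have h1 := ((hγ _ (hab u hu)).hasMFDerivWithinAt).comp u hm hsub
  have h2 := h1.mfderivWithin (uniqueMDiffWithinAt_Icc one_pos hu)
  change mfderivWithin 𝓘(ℝ, ℝ) 𝓘(ℝ, E) (γ ∘ fun s : ℝ ↦ a + s * b) (Icc (0 : ℝ) 1) u (1 : ℝ) = _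
  rw [h2]
  have h3 : (ContinuousLinearMap.toSpanSingleton ℝ b) (1 : ℝ) = b • (1 : ℝ) := by simp
  exact (congrArg (mfderivWithin 𝓘(ℝ, ℝ) 𝓘(ℝ, E) γ (Icc (0 : ℝ) 1) (a + u * b)) h3).trans
    (map_smul _ _ _)

variable [RiemannianBundle (fun x : M ↦ TangentSpace 𝓘(ℝ, E) x)]

lemma IsGeodesic.mdifferentiableOn {g : ℝ → M} (hg : IsGeodesic E g) :
    MDifferentiableOn 𝓘(ℝ, ℝ) 𝓘(ℝ, E) g (Icc 0 1) :=
  hg.smooth.mdifferentiableOn (by simp)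

/-- Affine reparametrisations (possibly orientation reversing) of geodesics are geodesics. -/
lemma IsGeodesic.comp_affine {g : ℝ → M} (hg : IsGeodesic E g) {a b : ℝ}
    (hab : ∀ u ∈ Icc (0 : ℝ) 1, a + u * b ∈ Icc (0 : ℝ) 1) :
    IsGeodesic E (fun s ↦ g (a + s * b)) := by
  obtain ⟨c, hc, hloc⟩ := hg.locally_minimizing
  refine ⟨hg.smooth.comp (t := Icc 0 1) ?_ (fun s hs ↦ hab s hs), |b| * c, ?_, ?_⟩
  · rw [contMDiffOn_iff_contDiffOn]
    fun_prop
  · intro u hu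
    have h := mfderivWithin_comp_affine hg.mdifferentiableOn hab hu
    change ‖(mfderivWithin 𝓘(ℝ, ℝ) 𝓘(ℝ, E) (fun s : ℝ ↦ g (a + s * b)) (Icc (0 : ℝ) 1) u (1 : ℝ)
      : TangentSpace 𝓘(ℝ, E) (g (a + u * b)))‖ = _
    rw [h, norm_smul, Real.norm_eq_abs]
    congr 1
    exact hc _ (hab u hu)
  · intro u hu
    obtain ⟨ε, hε, h⟩ := hloc _ (hab u hu)
    -- The `+ 1` keeps the quotient meaningful when `b = 0`.
    refine ⟨ε / (|b| + 1), by positivity, fun s hs s' hs' h1 h2 ↦ ?_⟩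
    have key : ∀ r, |r - u| < ε / (|b| + 1) → |a + r * b - (a + u * b)| < ε := by
      intro r hr
      rw [show a + r * b - (a + u * b) = (r - u) * b by ring, abs_mul]
      rw [lt_div_iff₀ (by positivity)] at hr
      nlinarith [abs_nonneg (r - u), abs_nonneg b]
    rw [h _ (hab s hs) _ (hab s' hs') (key s h1) (key s' h2),
      show a + s * b - (a + s' * b) = (s - s') * b by ring, abs_mul]
    ring

lemma IsGeodesic.velocity_comp_affine {g : ℝ → M} (hg : IsGeodesic E g) {a b : ℝ}
    (hab : ∀ u ∈ Icc (0 : ℝ) 1, a + u * b ∈ Icc (0 : ℝ) 1) {u : ℝ} (hu : u ∈ Icc (0 : ℝ) 1) :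
    velocity E (fun s ↦ g (a + s * b)) u =
      (⟨g (a + u * b), b • velocityVector E g (a + u * b)⟩ : TangentBundle 𝓘(ℝ, E) M) := by
  unfold velocity velocityVector
  rw [← mfderivWithin_comp_affine hg.mdifferentiableOn hab hu]

lemma affine_mem_Icc {s s' : ℝ} (hs : s ∈ Icc (0 : ℝ) 1) (hs' : s' ∈ Icc (0 : ℝ) 1) :
    ∀ u ∈ Icc (0 : ℝ) 1, s + u * (s' - s) ∈ Icc (0 : ℝ) 1 := by
  rintro u ⟨hu0, hu1⟩
  have : s + u * (s' - s) = (1 - u) * s + u * s' := by ring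
  rw [this]
  constructor
  · nlinarith [hs.1, hs'.1, mul_nonneg (sub_nonneg.2 hu1) hs.1, mul_nonneg hu0 hs'.1]
  · nlinarith [hs.2, hs'.2, mul_nonneg (sub_nonneg.2 hu1) (sub_nonneg.2 hs.2),
      mul_nonneg hu0 (sub_nonneg.2 hs'.2)]

/-- Uniform local minimality on the compact interval. -/
lemma IsGeodesic.exists_dist_eq {g : ℝ → M} (hg : IsGeodesic E g) :
    ∃ ε > 0, ∀ s ∈ Icc (0 : ℝ) 1, ∀ s' ∈ Icc (0 : ℝ) 1, |s - s'| < ε →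
      dist (g s) (g s') = ‖velocityVector E g 0‖ * |s - s'| := by
  obtain ⟨c, hc, hloc⟩ := hg.locally_minimizing
  have h0 : ‖velocityVector E g 0‖ = c := hc 0 (by simp)
  rw [h0]
  choose! ε hε h using hloc
  obtain ⟨δ, hδ, hL⟩ := lebesgue_number_lemma_of_metric (s := Icc (0 : ℝ) 1)
    (c := fun t : Icc (0 : ℝ) 1 ↦ Metric.ball (t : ℝ) (ε t)) isCompact_Icc
    (fun t ↦ Metric.isOpen_ball)
    (fun t ht ↦ mem_iUnion.2 ⟨⟨t, ht⟩, Metric.mem_ball_self (hε t ht)⟩)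
  refine ⟨δ, hδ, fun s hs s' hs' hss ↦ ?_⟩
  obtain ⟨t, ht⟩ := hL s hs
  refine h t t.2 s hs s' hs' ?_ ?_
  · simpa [Real.dist_eq] using ht (Metric.mem_ball_self hδ)
  · have := ht (show s' ∈ Metric.ball s δ by rwa [Metric.mem_ball, Real.dist_eq, abs_sub_comm])
    simpa [Real.dist_eq] using this

lemma IsGeodesic.norm_velocity {g : ℝ → M} (hg : IsGeodesic E g) {t : ℝ}
    (ht : t ∈ Icc (0 : ℝ) 1) : ‖velocityVector E g t‖ = ‖velocityVector E g 0‖ := by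
  obtain ⟨c, hc, -⟩ := hg.locally_minimizing
  exact (hc t ht).trans (hc 0 (by simp)).symm

/-- A geodesic is at least as long as the distance between its end points. -/
lemma IsGeodesic.dist_le {g : ℝ → M} (hg : IsGeodesic E g) :
    dist (g 0) (g 1) ≤ ‖velocityVector E g 0‖ := by
  obtain ⟨ε, hε, h⟩ := hg.exists_dist_eq
  obtain ⟨n, hn⟩ := exists_nat_one_div_lt hε
  set N : ℝ := (n : ℝ) + 1 with hN
  have hN0 : 0 < N := by positivity
  have h1 := dist_le_range_sum_dist (fun i : ℕ ↦ g (i / N)) (n + 1)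
  have h2 : ∀ i ∈ Finset.range (n + 1), dist (g ((i : ℕ) / N)) (g (((i + 1 : ℕ) : ℝ) / N))
      = ‖velocityVector E g 0‖ * (1 / N) := by
    intro i hi
    have hi' : (i : ℝ) + 1 ≤ N := by
      have := Finset.mem_range.1 hi
      rw [hN]; exact_mod_cast this
    have hsub : |(i : ℝ) / N - ((i + 1 : ℕ) : ℝ) / N| = 1 / N := by
      rw [← sub_div, abs_div, abs_of_pos hN0]
      congr 1
      push_cast
      simp
    rw [h _ ?_ _ ?_ (by rw [hsub]; exact hn), hsub]
    · exact ⟨by positivity, (div_le_one hN0).2 (by linarith)⟩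
    · push_cast
      exact ⟨by positivity, (div_le_one hN0).2 hi'⟩
  rw [Finset.sum_congr rfl h2] at h1
  have h3 : (((n + 1 : ℕ) : ℝ)) / N = 1 := by
    rw [hN]; push_cast; exact div_self hN0.ne'
  simp only [h3, Nat.cast_zero, zero_div, Finset.sum_const, Finset.card_range, nsmul_eq_mul] at h1
  refine h1.trans (le_of_eq ?_)
  rw [hN]; push_cast; field_simp

/-- Only an inequality is available, since a geodesic need not minimize globally. This is the
direction needed with an upper bound on `f`. -/
lemma IsExp.dist_le {x y : M} {v : TangentSpace 𝓘(ℝ, E) x} (h : IsExp x v y) :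
    dist x y ≤ ‖v‖ := by
  obtain ⟨g, hg, hv, rfl⟩ := h
  have h0 : g 0 = x := congrArg TotalSpace.proj hv
  subst h0
  have hv' : velocityVector E g 0 = v := by simpa [velocity_eq] using hv
  exact hv' ▸ hg.dist_le

/-- Sub-arcs, also reversed ones, are geodesics after affine reparametrisation. All collinearity of
inverse exponentials comes from here: seen from `g α`, the points `g 0` and `g 1` are reached by
`-α` and `1 - α` times the same velocity. -/
lemma IsGeodesic.isExp {g : ℝ → M} (hg : IsGeodesic E g) {s s' : ℝ}
    (hs : s ∈ Icc (0 : ℝ) 1) (hs' : s' ∈ Icc (0 : ℝ) 1) :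
    IsExp (g s) ((s' - s) • velocityVector E g s : TangentSpace 𝓘(ℝ, E) (g s)) (g s') := by
  refine ⟨_, hg.comp_affine (affine_mem_Icc hs hs'), ?_, by simp⟩
  rw [hg.velocity_comp_affine (affine_mem_Icc hs hs') (by simp)]
  have h : s + 0 * (s' - s) = s := by ring
  rw [h]

/-- In a uniquely geodesic manifold, `Exp_x` is injective. -/
lemma IsUniquelyGeodesic.isExp_unique (hM : IsUniquelyGeodesic E M) {x y : M}
    {v w : TangentSpace 𝓘(ℝ, E) x} (hv : IsExp x v y) (hw : IsExp x w y) : v = w := by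
  obtain ⟨g, hg, hgv, rfl⟩ := hv
  obtain ⟨g', hg', hgw, hy⟩ := hw
  have h0 : g 0 = x := congrArg TotalSpace.proj hgv
  have h0' : g' 0 = x := congrArg TotalSpace.proj hgw
  obtain ⟨γ, -, -, -, huniq⟩ := hM x (g 1)
  have h1 := velocity_congr (E := E) (huniq g hg h0 rfl) (t := 0) (by simp)
  have h2 := velocity_congr (E := E) (huniq g' hg' h0' hy) (t := 0) (by simp)
  have h3 := hgv.symm.trans (h1.trans (h2.symm.trans hgw))
  simpa using h3

/-- Unique geodesy rules out the default value `0` in `expInv`. -/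
lemma IsUniquelyGeodesic.isExp_expInv (hM : IsUniquelyGeodesic E M) (x y : M) :
    IsExp x (expInv E x y) y := by
  have h : ∃ v : TangentSpace 𝓘(ℝ, E) x, IsExp x v y := by
    obtain ⟨γ, hγ, rfl, rfl, -⟩ := hM x y
    exact ⟨velocityVector E γ 0, γ, hγ, rfl, rfl⟩
  unfold expInv
  rw [dif_pos h]
  exact h.choose_spec

lemma IsUniquelyGeodesic.expInv_eq (hM : IsUniquelyGeodesic E M) {x y : M}
    {v : TangentSpace 𝓘(ℝ, E) x} (h : IsExp x v y) : expInv E x y = v :=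
  hM.isExp_unique (hM.isExp_expInv x y) h

end Curves

/-- A function on `[0, 1]` with uniformly local affine minorants lies above the affine minorant
at the left end point. -/
lemma add_le_of_locally_subgradient {ψ m : ℝ → ℝ} {ε : ℝ} (hε : 0 < ε)
    (h : ∀ s ∈ Icc (0 : ℝ) 1, ∀ s' ∈ Icc (0 : ℝ) 1, |s - s'| < ε →
      ψ s + m s * (s' - s) ≤ ψ s') : ψ 0 + m 0 ≤ ψ 1 := by
  obtain ⟨n, hn⟩ := exists_nat_one_div_lt hε
  set N : ℝ := (n : ℝ) + 1 with hN
  have hN0 : 0 < N := by positivity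
  have key : ∀ i : ℕ, i ≤ n + 1 → m 0 ≤ m (i / N) ∧ ψ 0 + m 0 * (i / N) ≤ ψ (i / N) := by
    intro i
    induction i with
    | zero => simp
    | succ i ih =>
      intro hi
      obtain ⟨ih1, ih2⟩ := ih (by omega)
      have hi' : (i : ℝ) + 1 ≤ N := by rw [hN]; exact_mod_cast hi
      have e : ((i + 1 : ℕ) : ℝ) / N = i / N + 1 / N := by push_cast; ring
      have h1N : 0 < 1 / N := by positivity
      have hs : (i : ℝ) / N ∈ Icc (0 : ℝ) 1 :=
        ⟨by positivity, (div_le_one hN0).2 (by linarith)⟩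
      have hs' : (i : ℝ) / N + 1 / N ∈ Icc (0 : ℝ) 1 :=
        ⟨by positivity, by rw [← add_div]; exact (div_le_one hN0).2 hi'⟩
      rw [e]
      have a1 := h _ hs _ hs' (by
        rw [show (i : ℝ) / N - (i / N + 1 / N) = -(1 / N) by ring, abs_neg, abs_of_pos h1N]
        exact hn)
      have a2 := h _ hs' _ hs (by
        rw [show (i : ℝ) / N + 1 / N - i / N = 1 / N by ring, abs_of_pos h1N]
        exact hn)
      -- Adding the two subgradient inequalities between neighbouring nodes shows that the slopes
      -- increase.
      have hm : m (i / N) ≤ m (i / N + 1 / N) := by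
        by_contra hlt
        push Not at hlt
        nlinarith [mul_pos (sub_pos.2 hlt) h1N]
      refine ⟨ih1.trans hm, ?_⟩
      nlinarith [mul_le_mul_of_nonneg_right ih1 h1N.le]
  have := (key (n + 1) le_rfl).2
  have h3 : (((n + 1 : ℕ) : ℝ)) / N = 1 := by
    rw [hN]; push_cast; exact div_self hN0.ne'
  rw [h3] at this
  simpa using this

/-! ### Strong convexity measured by geodesic length -/

section Convex

variable {E : Type*} [NormedAddCommGroup E] [NormedSpace ℝ E] [FiniteDimensional ℝ E]
  {M : Type*} [MetricSpace M] [ChartedSpace E M]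
  [RiemannianBundle (fun x : M ↦ TangentSpace 𝓘(ℝ, E) x)]

/-- Strong convexity with the length of the geodesic in place of the distance. -/
lemma IsGeodesicallyStronglyConvex.lower_bound_expInv (hM : IsUniquelyGeodesic E M) {μ : ℝ}
    {f : M → ℝ} (hf : IsGeodesicallyStronglyConvex E μ f) (x y : M) :
    f x + inner ℝ (grad E f x) (expInv E x y) + μ / 2 * ‖expInv E x y‖ ^ 2 ≤ f y := by
  obtain ⟨g, hg, hgv, rfl⟩ := hM.isExp_expInv x y
  have h0 : g 0 = x := congrArg TotalSpace.proj hgv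
  subst h0
  obtain ⟨ε, hε, hd⟩ := hg.exists_dist_eq
  have hv : expInv E (g 0) (g 1) = velocityVector E g 0 := by
    simpa using hM.expInv_eq (hg.isExp (s := 0) (s' := 1) (by simp) (by simp))
  rw [hv]
  set c := ‖velocityVector E g 0‖ with hc
  -- Subtracting the parabola turns strong convexity into plain convexity: `s'² - s² - 2s(s' - s) =
  -- (s' - s)²`. On arcs shorter than `ε` the distance equals the length, so the hypothesis on `f`
  -- applies without loss.
  have := add_le_of_locally_subgradient (ψ := fun s ↦ f (g s) - μ / 2 * c ^ 2 * s ^ 2)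
    (m := fun s ↦ inner ℝ (grad E f (g s)) (velocityVector E g s) - μ * c ^ 2 * s) hε (by
      intro s hs s' hs' hss
      have h1 := hf.lower_bound (g s) (g s')
      rw [hM.expInv_eq (hg.isExp hs hs'), hd s hs s' hs' hss, inner_smul_right, mul_pow,
        sq_abs] at h1
      change _ ≤ f (g s') - μ / 2 * c ^ 2 * s' ^ 2
      linarith)
  rw [hc] at this ⊢
  linarith

end Convex

/-! ### The inequality in a single tangent space -/

section Algebra

variable {V : Type*} [NormedAddCommGroup V] [InnerProductSpace ℝ V]

/-- Convexity of the squared norm in unnormalised form. -/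
lemma norm_sq_smul_sub_smul_le {θ κ : ℝ} (hθ : 0 ≤ θ) (hκ : 0 ≤ κ) (a b : V) :
    ‖θ • a - (θ + κ) • b‖ ^ 2 ≤ (θ + κ) * (θ * ‖a - b‖ ^ 2 + κ * ‖b‖ ^ 2) := by
  have e : θ • a - (θ + κ) • b = θ • (a - b) - κ • b := by module
  have h1 := norm_sub_sq_real (θ • (a - b)) (κ • b)
  have h2 := norm_add_sq_real (a - b) b
  -- The gap between the two sides of the claim is exactly `θκ` times this square.
  have h3 : 0 ≤ ‖(a - b) + b‖ ^ 2 := by positivity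
  rw [inner_smul_left, inner_smul_right, norm_smul, norm_smul, mul_pow, mul_pow] at h1
  simp only [Real.norm_eq_abs, sq_abs, conj_trivial] at h1
  rw [e, h1]
  rw [h2] at h3
  nlinarith [mul_nonneg (mul_nonneg hθ hκ) h3]

/-- The potential decrease, for abstract tangent vectors: `g` is the gradient at the new point,
`a`, `b`, `-κ a` the inverse exponentials of the points `z`, `x_*`, `y`. -/
lemma potential_decrease {g a b : V} {fx fy fs fy' μ Δ ξ α r D : ℝ} (hμ : 0 ≤ μ) (hΔ : 0 < Δ)
    (hξ0 : 0 < ξ) (hξ1 : ξ < 1) (hξμ : 2 * μ * Δ ≤ ξ)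
    (hα : α = (ξ - 2 * μ * Δ) / (1 - 2 * μ * Δ))
    (hy' : fy' ≤ fx - Δ * ‖g‖ ^ 2)
    (hs : fx + inner ℝ g b + μ / 2 * ‖b‖ ^ 2 ≤ fs)
    (hy : (1 - α) * fx - α * inner ℝ g a ≤ (1 - α) * fy)
    (hD : ξ * (ξ - 2 * μ * Δ) * ‖a - b‖ ^ 2 ≤ 4 * Δ * (1 - ξ) * r * D) :
    fy' - fs + ξ ^ 2 / (4 * Δ)
        * ‖(1 - 2 * μ * Δ * ξ⁻¹) • a - (2 * Δ * ξ⁻¹) • g - b‖ ^ 2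
      ≤ (1 - ξ) * (fy - fs + r * D) := by
  have hκ : 0 ≤ 2 * μ * Δ := by positivity
  set κ := 2 * μ * Δ with hκ'
  have hκ1 : 0 < 1 - κ := by linarith
  have e1 : (ξ - κ) • a - ξ • b - (2 * Δ) • g
      = ξ • ((1 - κ * ξ⁻¹) • a - (2 * Δ * ξ⁻¹) • g - b) := by
    simp only [smul_sub, smul_smul]
    rw [show ξ * (1 - κ * ξ⁻¹) = ξ - κ by field_simp, show ξ * (2 * Δ * ξ⁻¹) = 2 * Δ by field_simp]
    abel
  have e2 : ξ ^ 2 * ‖(1 - κ * ξ⁻¹) • a - (2 * Δ * ξ⁻¹) • g - b‖ ^ 2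
      = ‖(ξ - κ) • a - ξ • b - (2 * Δ) • g‖ ^ 2 := by
    rw [e1, norm_smul, mul_pow, Real.norm_eq_abs, sq_abs]
  have e3 := norm_sub_sq_real ((ξ - κ) • a - ξ • b) ((2 * Δ) • g)
  rw [inner_sub_left, inner_smul_left, inner_smul_left, inner_smul_right, inner_smul_right,
    norm_smul, mul_pow, Real.norm_eq_abs, sq_abs, real_inner_comm g a, real_inner_comm g b] at e3
  simp only [conj_trivial] at e3
  have e4 := norm_sq_smul_sub_smul_le (sub_nonneg.2 hξμ) hκ a b
  rw [sub_add_cancel] at e4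
  -- Hence `(1 - κ)(1 - α) = 1 - ξ`, so scaling `hy` by `1 - κ` produces the weights of the
  -- conclusion.
  have hα1 : (1 - κ) * α = ξ - κ := by rw [hα]; field_simp
  have hy2 : (1 - ξ) * fx - (ξ - κ) * inner ℝ g a ≤ (1 - ξ) * fy := by
    have := mul_le_mul_of_nonneg_left hy hκ1.le
    have e5 : (1 - κ) * (1 - α) = 1 - ξ := by linarith
    calc (1 - ξ) * fx - (ξ - κ) * inner ℝ g a
        = (1 - κ) * ((1 - α) * fx - α * inner ℝ g a) := by rw [← e5, ← hα1]; ring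
      _ ≤ _ := this
      _ = (1 - ξ) * fy := by rw [← e5]; ring
  have hs2 := mul_le_mul_of_nonneg_left hs hξ0.le
  rw [div_mul_eq_mul_div, e2, e3]
  set P := ‖(ξ - κ) • a - ξ • b‖ ^ 2
  have hP : (P - 2 * ((ξ - κ) * (2 * Δ * inner ℝ g a) - ξ * (2 * Δ * inner ℝ g b))
      + (2 * Δ) ^ 2 * ‖g‖ ^ 2) / (4 * Δ)
      = P / (4 * Δ) - ((ξ - κ) * inner ℝ g a - ξ * inner ℝ g b) + Δ * ‖g‖ ^ 2 := by
    field_simp; ring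
  rw [hP]
  -- The strong convexity term arises because `ξκ / (4Δ) = ξμ/2`; the other term is `hD`.
  have hP2 : P / (4 * Δ) ≤ (1 - ξ) * (r * D) + ξ * (μ / 2 * ‖b‖ ^ 2) := by
    rw [div_le_iff₀ (by positivity)]
    rw [hκ'] at e4 hD
    nlinarith
  linarith

end Algebra

/-! ### Calculus of variations for the energy in a chart -/

section EulerLagrange

set_option maxSynthPendingDepth 3

open MeasureTheory Filter Topology
open scoped Interval

variable {E : Type*} [NormedAddCommGroup E] [NormedSpace ℝ E]

/-- The image of `c` is compact, so a whole neighbourhood of fixed width stays in `U`, and `h` is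
bounded. -/
lemma exists_forall_add_smul_mem {r : ℝ} {c h : ℝ → E} {U : Set E} (hU : IsOpen U)
    (hc : ContinuousOn c (Icc 0 r)) (hcU : ∀ t ∈ Icc (0 : ℝ) r, c t ∈ U)
    (hh : ContinuousOn h (Icc 0 r)) :
    ∃ ε₀ > 0, ∀ ε : ℝ, |ε| ≤ ε₀ → ∀ t ∈ Icc (0 : ℝ) r, c t + ε • h t ∈ U := by
  have hK : IsCompact (c '' Icc 0 r) := isCompact_Icc.image_of_continuousOn hc
  obtain ⟨δ, hδ, hsub⟩ := hK.exists_cthickening_subset_open hU (by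
    rintro _ ⟨t, ht, rfl⟩; exact hcU t ht)
  obtain ⟨B, hB⟩ := isCompact_Icc.exists_bound_of_continuousOn hh
  refine ⟨δ / (|B| + 1), by positivity, fun ε hε t ht ↦ hsub ?_⟩
  refine Metric.mem_cthickening_of_dist_le _ (c t) _ _ (mem_image_of_mem _ ht) ?_
  rw [dist_eq_norm, add_sub_cancel_left, norm_smul, Real.norm_eq_abs]
  rw [le_div_iff₀ (by positivity)] at hε
  have := (hB t ht).trans (le_abs_self B)
  nlinarith [abs_nonneg ε, norm_nonneg (h t)]

set_option maxHeartbeats 800000 in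
/-- Differentiation of the energy along a linear variation. -/
lemma hasDerivAt_energy {r : ℝ} (hr : 0 < r) {U : Set E} (hU : IsOpen U)
    {G : E → E →L[ℝ] E →L[ℝ] ℝ} (hG : ContDiffOn ℝ 1 G U)
    {c c' h h' : ℝ → E} (hc : ContinuousOn c (Icc 0 r)) (hc' : ContinuousOn c' (Icc 0 r))
    (hh : ContinuousOn h (Icc 0 r)) (hh' : ContinuousOn h' (Icc 0 r))
    (hcU : ∀ t ∈ Icc (0 : ℝ) r, c t ∈ U) :
    HasDerivAt (fun ε : ℝ ↦ ∫ t in (0 : ℝ)..r,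
        G (c t + ε • h t) (c' t + ε • h' t) (c' t + ε • h' t))
      (∫ t in (0 : ℝ)..r, (fderiv ℝ G (c t) (h t) (c' t) (c' t)
        + G (c t) (h' t) (c' t) + G (c t) (c' t) (h' t))) 0 := by
  obtain ⟨ε₀, hε₀, hmem⟩ := exists_forall_add_smul_mem hU hc hcU hh
  have hGd : ContinuousOn (fderiv ℝ G) U := hG.continuousOn_fderiv_of_isOpen hU le_rfl
  let F : ℝ → ℝ → ℝ := fun ε t ↦ G (c t + ε • h t) (c' t + ε • h' t) (c' t + ε • h' t)
  let F' : ℝ → ℝ → ℝ := fun ε t ↦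
    fderiv ℝ G (c t + ε • h t) (h t) (c' t + ε • h' t) (c' t + ε • h' t)
      + G (c t + ε • h t) (h' t) (c' t + ε • h' t) + G (c t + ε • h t) (c' t + ε • h' t) (h' t)
  -- On this compact rectangle the derivative of the integrand is continuous, so a constant serves
  -- as dominating function.
  let S : Set (ℝ × ℝ) := Icc (-ε₀) ε₀ ×ˢ Icc 0 r
  have hS : IsCompact S := isCompact_Icc.prod isCompact_Icc
  have snd_maps : MapsTo (Prod.snd : ℝ × ℝ → ℝ) S (Icc 0 r) := fun p hp ↦ hp.2
  have lift : ∀ {k : ℝ → E}, ContinuousOn k (Icc 0 r) → ContinuousOn (fun p : ℝ × ℝ ↦ k p.2) S :=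
    fun hk ↦ hk.comp continuousOn_snd snd_maps
  have hmemS : MapsTo (fun p : ℝ × ℝ ↦ c p.2 + p.1 • h p.2) S U :=
    fun p hp ↦ hmem p.1 (abs_le.2 hp.1) p.2 hp.2
  have hu : ContinuousOn (fun p : ℝ × ℝ ↦ c p.2 + p.1 • h p.2) S :=
    (lift hc).add (continuousOn_fst.smul (lift hh))
  have hv : ContinuousOn (fun p : ℝ × ℝ ↦ c' p.2 + p.1 • h' p.2) S :=
    (lift hc').add (continuousOn_fst.smul (lift hh'))
  have hGS := hG.continuousOn.comp hu hmemS
  have hGdS := hGd.comp hu hmemS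
  have hFc : ContinuousOn (fun p : ℝ × ℝ ↦ F p.1 p.2) S := (hGS.clm_apply hv).clm_apply hv
  have hF'c : ContinuousOn (fun p : ℝ × ℝ ↦ F' p.1 p.2) S :=
    ((((hGdS.clm_apply (lift hh)).clm_apply hv).clm_apply hv).add
      ((hGS.clm_apply (lift hh')).clm_apply hv)).add ((hGS.clm_apply hv).clm_apply (lift hh'))
  have slice : ∀ {k : ℝ × ℝ → ℝ} {ε : ℝ}, ContinuousOn k S → |ε| ≤ ε₀ →
      ContinuousOn (fun t ↦ k (ε, t)) (Icc 0 r) := fun {k ε} hk hε ↦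
    hk.comp (by fun_prop) (fun t ht ↦ ⟨abs_le.1 hε, ht⟩)
  obtain ⟨B, hB⟩ := hS.exists_bound_of_continuousOn hF'c
  have hIoc : Ι (0 : ℝ) r = Ioc 0 r := uIoc_of_le hr.le
  have h0 : |(0 : ℝ)| ≤ ε₀ := by simpa using hε₀.le
  have hball : ∀ ε ∈ Metric.ball (0 : ℝ) ε₀, |ε| ≤ ε₀ := by
    intro ε hε
    have := Metric.mem_ball.1 hε
    rw [Real.dist_eq, sub_zero] at this
    exact this.le
  have meas : ∀ {k : ℝ → ℝ}, ContinuousOn k (Icc 0 r) →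
      AEStronglyMeasurable k (volume.restrict (Ι (0 : ℝ) r)) := by
    intro k hk
    rw [hIoc]
    exact (hk.mono Ioc_subset_Icc_self).aestronglyMeasurable measurableSet_Ioc
  have main := (intervalIntegral.hasDerivAt_integral_of_dominated_loc_of_deriv_le
    (μ := volume) (F := F) (F' := F') (x₀ := 0) (s := Metric.ball 0 ε₀) (a := 0) (b := r)
    (bound := fun _ ↦ B) (Metric.ball_mem_nhds _ hε₀)
    (by
      filter_upwards [Metric.ball_mem_nhds (0 : ℝ) hε₀] with ε hε
      exact meas (slice hFc (hball ε hε)))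
    (by
      refine ContinuousOn.intervalIntegrable ?_
      rw [uIcc_of_le hr.le]
      exact slice hFc h0)
    (meas (slice hF'c h0))
    (by
      refine Eventually.of_forall fun t ht ε hε ↦ ?_
      rw [hIoc] at ht
      exact hB (ε, t) ⟨abs_le.1 (hball ε hε), Ioc_subset_Icc_self ht⟩)
    (by simp)
    (by
      refine Eventually.of_forall fun t ht ε hε ↦ ?_
      rw [hIoc] at ht
      have hm := hmem ε (hball ε hε) t (Ioc_subset_Icc_self ht)
      have hGda : HasFDerivAt G (fderiv ℝ G (c t + ε • h t)) (c t + ε • h t) :=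
        ((hG.differentiableOn one_ne_zero).differentiableAt (hU.mem_nhds hm)).hasFDerivAt
      have d1 : HasDerivAt (fun ε : ℝ ↦ c t + ε • h t) (h t) ε := by
        simpa using ((hasDerivAt_id ε).smul_const (h t)).const_add (c t)
      have d2 : HasDerivAt (fun ε : ℝ ↦ c' t + ε • h' t) (h' t) ε := by
        simpa using ((hasDerivAt_id ε).smul_const (h' t)).const_add (c' t)
      have d3 := ((hGda.comp_hasDerivAt ε d1).clm_apply d2).clm_apply d2
      refine d3.congr_deriv ?_
      simp [F'])).2
  simpa [F, F'] using main

/-- The Euler-Lagrange equation for the energy of a metric `G`. -/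
lemma eulerLagrange {r : ℝ} (hr : 0 < r) {U : Set E} (hU : IsOpen U)
    {G : E → E →L[ℝ] E →L[ℝ] ℝ} (hG : ContDiffOn ℝ ∞ G U)
    (hsymm : ∀ u ∈ U, ∀ v w, G u v w = G u w v)
    {c c' : ℝ → E} (hc : ContDiffOn ℝ ∞ c (Icc 0 r)) (hc' : ContDiffOn ℝ ∞ c' (Icc 0 r))
    (hcU : ∀ t ∈ Icc (0 : ℝ) r, c t ∈ U)
    (hmin : ∀ h h' : ℝ → E, ContinuousOn h' (Icc 0 r) →
      (∀ t ∈ Icc 0 r, HasDerivWithinAt h (h' t) (Icc 0 r) t) → h 0 = 0 → h r = 0 →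
      ∀ᶠ ε : ℝ in 𝓝 0, ∫ t in (0 : ℝ)..r, G (c t) (c' t) (c' t) ≤
        ∫ t in (0 : ℝ)..r, G (c t + ε • h t) (c' t + ε • h' t) (c' t + ε • h' t))
    (e : E) {t : ℝ} (ht : t ∈ Icc (0 : ℝ) r) :
    HasDerivWithinAt (fun s ↦ G (c s) (c' s) e)
      (1 / 2 * fderiv ℝ G (c t) e (c' t) (c' t)) (Icc 0 r) t := by
  have hud : UniqueDiffOn ℝ (Icc (0 : ℝ) r) := uniqueDiffOn_Icc hr
  let P : ℝ → ℝ := fun s ↦ G (c s) (c' s) e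
  let P' : ℝ → ℝ := derivWithin P (Icc 0 r)
  let Q : ℝ → ℝ := fun s ↦ 1 / 2 * fderiv ℝ G (c s) e (c' s) (c' s)
  have hGc : ContDiffOn ℝ ∞ (fun s ↦ G (c s)) (Icc 0 r) := hG.comp hc hcU
  have hGdc : ContDiffOn ℝ ∞ (fun s ↦ fderiv ℝ G (c s)) (Icc 0 r) :=
    (hG.fderiv_of_isOpen hU (by simp)).comp hc hcU
  have hP : ContDiffOn ℝ ∞ P (Icc 0 r) := (hGc.clm_apply hc').clm_apply contDiffOn_const
  have hP' : ContDiffOn ℝ ∞ P' (Icc 0 r) := hP.derivWithin hud (by simp)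
  have hQ : ContDiffOn ℝ ∞ Q (Icc 0 r) :=
    contDiffOn_const.mul (((hGdc.clm_apply contDiffOn_const).clm_apply hc').clm_apply hc')
  have hPd : ∀ s ∈ Icc 0 r, HasDerivWithinAt P (P' s) (Icc 0 r) s := fun s hs ↦
    ((hP.differentiableOn (by simp)) s hs).hasDerivWithinAt
  let D : ℝ → ℝ := fun s ↦ P' s - Q s
  have hD : ContDiffOn ℝ ∞ D (Icc 0 r) := hP'.sub hQ
  -- The Euler-Lagrange defect `D` itself is the test function, with a weight vanishing at both ends
  -- and positive between. After integration by parts the first variation is `-2 ∫ s (r - s) D²`,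
  -- which forces `D = 0`.
  let η : ℝ → ℝ := fun s ↦ s * (r - s) * D s
  have hη : ContDiffOn ℝ ∞ η (Icc 0 r) := by
    refine ContDiffOn.mul ?_ hD
    fun_prop
  let η' : ℝ → ℝ := derivWithin η (Icc 0 r)
  have hη' : ContDiffOn ℝ ∞ η' (Icc 0 r) := hη.derivWithin hud (by simp)
  have hηd : ∀ s ∈ Icc 0 r, HasDerivWithinAt η (η' s) (Icc 0 r) s := fun s hs ↦
    ((hη.differentiableOn (by simp)) s hs).hasDerivWithinAt
  have hη0 : η 0 = 0 := by simp [η]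
  have hηr : η r = 0 := by simp [η]
  have hev := hmin (fun s ↦ η s • e) (fun s ↦ η' s • e)
    (hη'.continuousOn.smul continuousOn_const)
    (fun s hs ↦ (hηd s hs).smul_const e) (by simp [hη0]) (by simp [hηr])
  have hder := hasDerivAt_energy hr hU (hG.of_le (by simp)) hc.continuousOn hc'.continuousOn
    (hη.continuousOn.smul continuousOn_const) (hη'.continuousOn.smul continuousOn_const)
    (h := fun s ↦ η s • e) (h' := fun s ↦ η' s • e) hcU
  have hzero := IsLocalMin.hasDerivAt_eq_zero (by
    refine hev.mono fun ε hε ↦ ?_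
    simpa using hε) hder
  have integrable : ∀ {k : ℝ → ℝ}, ContinuousOn k (Icc 0 r) →
      IntervalIntegrable k volume 0 r := by
    intro k hk
    refine ContinuousOn.intervalIntegrable ?_
    rwa [uIcc_of_le hr.le]
  have hcongr : ∫ s in (0 : ℝ)..r, (fderiv ℝ G (c s) (η s • e) (c' s) (c' s)
        + G (c s) (η' s • e) (c' s) + G (c s) (c' s) (η' s • e))
      = ∫ s in (0 : ℝ)..r, (2 * (P' s * η s + P s * η' s) - 2 * (s * (r - s) * D s ^ 2)) := by
    refine intervalIntegral.integral_congr fun s hs ↦ ?_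
    rw [uIcc_of_le hr.le] at hs
    simp only [map_smul, smul_apply, smul_eq_mul]
    rw [hsymm _ (hcU s hs) e (c' s)]
    simp only [P, η, D, Q]
    ring
  have hparts : ∫ s in (0 : ℝ)..r, (P' s * η s + P s * η' s) = 0 := by
    rw [intervalIntegral.integral_eq_sub_of_hasDerivAt_of_le hr.le (f := fun s ↦ P s * η s)]
    · simp [hη0, hηr]
    · exact hP.continuousOn.mul hη.continuousOn
    · intro s hs
      have hm := Icc_mem_nhds hs.1 hs.2
      exact ((hPd s (Ioo_subset_Icc_self hs)).hasDerivAt hm).mul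
        ((hηd s (Ioo_subset_Icc_self hs)).hasDerivAt hm)
    · exact integrable ((hP'.continuousOn.mul hη.continuousOn).add
        (hP.continuousOn.mul hη'.continuousOn))
  have hWc : ContinuousOn (fun s : ℝ ↦ s * (r - s) * D s ^ 2) (Icc 0 r) :=
    ContinuousOn.mul (by fun_prop) (hD.continuousOn.pow 2)
  rw [hcongr, intervalIntegral.integral_sub, intervalIntegral.integral_const_mul,
    intervalIntegral.integral_const_mul, hparts] at hzero
  rotate_left
  · exact (integrable ((hP'.continuousOn.mul hη.continuousOn).add
        (hP.continuousOn.mul hη'.continuousOn))).const_mul 2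
  · exact (integrable hWc).const_mul 2
  have hD0 : EqOn D 0 (Ioo 0 r) := by
    intro s hs
    by_contra hne
    have : 0 < ∫ s in (0 : ℝ)..r, s * (r - s) * D s ^ 2 := by
      refine intervalIntegral.integral_pos hr hWc (fun s hs ↦ ?_)
        ⟨s, Ioo_subset_Icc_self hs, ?_⟩
      · exact mul_nonneg (mul_nonneg hs.1.le (sub_nonneg.2 hs.2)) (sq_nonneg _)
      · exact mul_pos (mul_pos hs.1 (sub_pos.2 hs.2)) (by have h1 : D s ≠ 0 := hne; positivity)
    linarith
  have hD1 : EqOn D 0 (Icc 0 r) := hD0.of_subset_closure hD.continuousOn continuousOn_const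
    Ioo_subset_Icc_self (by rw [closure_Ioo hr.ne])
  have := hPd t ht
  rwa [show P' t = Q t from sub_eq_zero.1 (hD1 ht)] at this

/-- As `K` need not be convex, the mean value inequality is not applied on it directly: local
Lipschitz bounds are patched by compactness. -/
lemma ContDiffOn.exists_norm_sub_le {F F' : Type*} [NormedAddCommGroup F] [NormedSpace ℝ F]
    [NormedAddCommGroup F'] [NormedSpace ℝ F'] {f : F → F'} {U K : Set F} (hU : IsOpen U)
    (hf : ContDiffOn ℝ 1 f U) (hK : IsCompact K) (hKU : K ⊆ U) :
    ∃ C : ℝ, 0 ≤ C ∧ ∀ x ∈ K, ∀ y ∈ K, ‖f x - f y‖ ≤ C * ‖x - y‖ := by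
  have hloc : LocallyLipschitzOn K f := by
    intro x hx
    obtain ⟨C, t, ht, h⟩ :=
      ((hf.contDiffAt (hU.mem_nhds (hKU hx)))).exists_lipschitzOnWith
    exact ⟨C, t, mem_nhdsWithin_of_mem_nhds ht, h⟩
  obtain ⟨C, hC⟩ := hloc.exists_lipschitzOnWith_of_compact hK
  refine ⟨C, C.2, fun x hx y hy ↦ ?_⟩
  simpa [dist_eq_norm] using hC.dist_le_mul x hx y hy

lemma HasDerivWithinAt.dual_apply {p : ℝ → E →L[ℝ] ℝ} {p' : E →L[ℝ] ℝ} {s : Set ℝ} {t : ℝ}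
    (h : HasDerivWithinAt p p' s t) (e : E) : HasDerivWithinAt (fun s ↦ p s e) (p' e) s t :=
  (ContinuousLinearMap.apply ℝ ℝ e).hasFDerivAt.comp_hasDerivWithinAt t h

/-- Uniform ellipticity of a positive definite form over a compact set. -/
lemma exists_uniform_posDef [FiniteDimensional ℝ E] {G : E → E →L[ℝ] E →L[ℝ] ℝ} {K : Set E}
    (hK : IsCompact K) (hG : ContinuousOn G K) (hpos : ∀ u ∈ K, ∀ v, v ≠ 0 → 0 < G u v v) :
    ∃ m > 0, ∀ u ∈ K, ∀ v, m * ‖v‖ ^ 2 ≤ G u v v := by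
  have : ProperSpace E := FiniteDimensional.proper ℝ E
  have hcont : ContinuousOn (fun p : E × E ↦ G p.1 p.2 p.2) (K ×ˢ Metric.sphere 0 1) :=
    ((hG.comp continuousOn_fst fun p hp ↦ hp.1).clm_apply continuousOn_snd).clm_apply
      continuousOn_snd
  obtain ⟨m, hm, h⟩ := (hK.prod (isCompact_sphere (0 : E) 1)).exists_forall_le' hcont (a := 0)
    (by
      rintro ⟨u, v⟩ ⟨hu, hv⟩
      refine hpos u hu v ?_
      rintro rfl
      simp at hv)
  refine ⟨m, hm, fun u hu v ↦ ?_⟩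
  by_cases hv : v = 0
  · simp [hv]
  have hn : 0 < ‖v‖ := norm_pos_iff.2 hv
  have := h (u, ‖v‖⁻¹ • v) ⟨hu, by simp [norm_smul, hn.ne']⟩
  simp only [map_smul, smul_apply, smul_eq_mul] at this
  have e : G u v v = ‖v‖ ^ 2 * (‖v‖⁻¹ * (‖v‖⁻¹ * G u v v)) := by field_simp
  rw [e]
  nlinarith [sq_nonneg ‖v‖]

/-- Solutions of the Euler-Lagrange equation are determined by their initial data. -/
lemma eulerLagrange_unique [FiniteDimensional ℝ E] {r : ℝ} (hr : 0 < r) {U : Set E}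
    (hU : IsOpen U) {G : E → E →L[ℝ] E →L[ℝ] ℝ} (hG : ContDiffOn ℝ ∞ G U)
    (hpos : ∀ u ∈ U, ∀ v, v ≠ 0 → 0 < G u v v) {c c' : Fin 2 → ℝ → E}
    (hc : ∀ i, ∀ t ∈ Icc (0 : ℝ) r, HasDerivWithinAt (c i) (c' i t) (Icc 0 r) t)
    (hc' : ∀ i, ContDiffOn ℝ ∞ (c' i) (Icc 0 r))
    (hcU : ∀ i, ∀ t ∈ Icc (0 : ℝ) r, c i t ∈ U)
    (hEL : ∀ i, ∀ t ∈ Icc (0 : ℝ) r, ∀ e, HasDerivWithinAt (fun s ↦ G (c i s) (c' i s) e)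
      (1 / 2 * fderiv ℝ G (c i t) e (c' i t) (c' i t)) (Icc 0 r) t)
    (h0 : c 0 0 = c 1 0) (h0' : c' 0 0 = c' 1 0) : EqOn (c 0) (c 1) (Icc 0 r) := by
  have : ProperSpace E := FiniteDimensional.proper ℝ E
  have hcc : ∀ i, ContinuousOn (c i) (Icc 0 r) := fun i t ht ↦ (hc i t ht).continuousWithinAt
  have hud : UniqueDiffOn ℝ (Icc (0 : ℝ) r) := uniqueDiffOn_Icc hr
  let K : Set E := c 0 '' Icc 0 r ∪ c 1 '' Icc 0 r
  let K' : Set E := c' 0 '' Icc 0 r ∪ c' 1 '' Icc 0 r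
  have hK : IsCompact K := (isCompact_Icc.image_of_continuousOn (hcc 0)).union
    (isCompact_Icc.image_of_continuousOn (hcc 1))
  have hK' : IsCompact K' := (isCompact_Icc.image_of_continuousOn (hc' 0).continuousOn).union
    (isCompact_Icc.image_of_continuousOn (hc' 1).continuousOn)
  have hKU : K ⊆ U := by
    rintro _ (⟨t, ht, rfl⟩ | ⟨t, ht, rfl⟩)
    exacts [hcU 0 t ht, hcU 1 t ht]
  have memK : ∀ i, ∀ t ∈ Icc (0 : ℝ) r, c i t ∈ K := by
    intro i t ht
    fin_cases i
    exacts [Or.inl ⟨t, ht, rfl⟩, Or.inr ⟨t, ht, rfl⟩]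
  have memK' : ∀ i, ∀ t ∈ Icc (0 : ℝ) r, c' i t ∈ K' := by
    intro i t ht
    fin_cases i
    exacts [Or.inl ⟨t, ht, rfl⟩, Or.inr ⟨t, ht, rfl⟩]
  obtain ⟨m, hm, hell⟩ := exists_uniform_posDef hK (hG.continuousOn.mono hKU)
    fun u hu ↦ hpos u (hKU hu)
  obtain ⟨C₁, hC₁, hL₁⟩ := ContDiffOn.exists_norm_sub_le hU (hG.of_le (by simp)) hK hKU
  obtain ⟨R, hR⟩ := hK'.exists_bound_of_continuousOn (f := fun v : E ↦ v) continuousOn_id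
  -- The equation is treated in Hamiltonian form, with momentum `p = G(c) c'` and `p' = Φ(c, c')`,
  -- which avoids solving for `c''`.
  let Φ : E × E → (E →L[ℝ] ℝ) := fun p ↦
    (1 / 2 : ℝ) • (((fderiv ℝ G p.1).flip p.2).flip p.2)
  have hΦ : ContDiffOn ℝ 1 Φ (U ×ˢ univ) := by
    have h1 : ContDiffOn ℝ 1 (fun p : E × E ↦ fderiv ℝ G p.1) (U ×ˢ univ) :=
      ((hG.fderiv_of_isOpen hU (m := ∞) (by simp)).of_le (by simp)).comp
        contDiff_fst.contDiffOn fun p hp ↦ hp.1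
    have h2 : ContDiffOn ℝ 1 (fun p : E × E ↦ (fderiv ℝ G p.1).flip) (U ×ˢ univ) :=
      (ContinuousLinearMap.flipₗᵢ ℝ E E (E →L[ℝ] ℝ)).contDiff.comp_contDiffOn h1
    have h3 := (ContinuousLinearMap.flipₗᵢ ℝ E E ℝ).contDiff.comp_contDiffOn
      (h2.clm_apply contDiff_snd.contDiffOn)
    exact (h3.clm_apply contDiff_snd.contDiffOn).const_smul (1 / 2 : ℝ)
  obtain ⟨C₂, hC₂, hL₂⟩ := ContDiffOn.exists_norm_sub_le (hU.prod isOpen_univ) hΦ (hK.prod hK')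
    (prod_mono hKU (subset_univ _))
  let p : Fin 2 → ℝ → (E →L[ℝ] ℝ) := fun i t ↦ G (c i t) (c' i t)
  have hp : ∀ i, ∀ t ∈ Icc (0 : ℝ) r, HasDerivWithinAt (p i) (Φ (c i t, c' i t)) (Icc 0 r) t := by
    intro i t ht
    have hGd : DifferentiableWithinAt ℝ (fun s ↦ G (c i s)) (Icc 0 r) t :=
      ((hG.differentiableOn (by simp)).differentiableAt
        (hU.mem_nhds (hcU i t ht))).comp_differentiableWithinAt t
        (hc i t ht).differentiableWithinAt
    have hd : DifferentiableWithinAt ℝ (p i) (Icc 0 r) t :=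
      hGd.clm_apply ((hc' i).differentiableOn (by simp) t ht)
    have h1 := hd.hasDerivWithinAt
    have h2 : derivWithin (p i) (Icc 0 r) t = Φ (c i t, c' i t) := by
      ext e
      have h3 := (hud t ht).eq_deriv _ (HasDerivWithinAt.dual_apply h1 e) (hEL i t ht e)
      rw [h3]
      simp [Φ]
    rw [h2] at h1
    exact h1
  let Y : ℝ → E × (E →L[ℝ] ℝ) := fun t ↦ (c 0 t - c 1 t, p 0 t - p 1 t)
  let Y' : ℝ → E × (E →L[ℝ] ℝ) := fun t ↦
    (c' 0 t - c' 1 t, Φ (c 0 t, c' 0 t) - Φ (c 1 t, c' 1 t))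
  have hY : ∀ t ∈ Icc (0 : ℝ) r, HasDerivWithinAt Y (Y' t) (Icc 0 r) t := fun t ht ↦
    ((hc 0 t ht).sub (hc 1 t ht)).prodMk ((hp 0 t ht).sub (hp 1 t ht))
  have hR0 : 0 ≤ R := (norm_nonneg _).trans (hR _ (memK' 0 0 ⟨le_rfl, hr.le⟩))
  set A : ℝ := (1 + C₁ * R) / m with hA
  have hA0 : 0 ≤ A := by positivity
  have bound1 : ∀ t ∈ Icc (0 : ℝ) r, ‖c' 0 t - c' 1 t‖ ≤ A * ‖Y t‖ := by
    intro t ht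
    set w := c' 0 t - c' 1 t with hw
    -- Ellipticity recovers the velocity difference `w` from the differences in position and
    -- momentum, closing the Grönwall estimate for `Y`.
    have e1 : G (c 0 t) w w = (p 0 t - p 1 t) w - (G (c 0 t) - G (c 1 t)) (c' 1 t) w := by
      simp [p, hw]
    have n1 : (p 0 t - p 1 t) w ≤ ‖Y t‖ * ‖w‖ :=
      (le_abs_self _).trans (((p 0 t - p 1 t).le_opNorm w).trans
        (mul_le_mul_of_nonneg_right (norm_snd_le (Y t)) (norm_nonneg _)))
    have n2 : -((G (c 0 t) - G (c 1 t)) (c' 1 t) w) ≤ C₁ * R * ‖Y t‖ * ‖w‖ := by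
      refine (neg_le_abs _).trans ?_
      have h1 := ((G (c 0 t) - G (c 1 t)).le_opNorm₂ (c' 1 t) w)
      have h2 := hL₁ _ (memK 0 t ht) _ (memK 1 t ht)
      have h3 : ‖c 0 t - c 1 t‖ ≤ ‖Y t‖ := norm_fst_le (Y t)
      have h4 := hR _ (memK' 1 t ht)
      calc _ ≤ ‖G (c 0 t) - G (c 1 t)‖ * ‖c' 1 t‖ * ‖w‖ := h1
        _ ≤ (C₁ * ‖Y t‖) * R * ‖w‖ := by
          gcongr
          exact h2.trans (by gcongr)
        _ = _ := by ring
    have h5 := hell _ (memK 0 t ht) w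
    rw [e1] at h5
    by_cases hw0 : ‖w‖ = 0
    · rw [hw0]; positivity
    have hw1 : 0 < ‖w‖ := lt_of_le_of_ne (norm_nonneg _) (Ne.symm hw0)
    rw [hA, div_mul_eq_mul_div, le_div_iff₀ hm]
    refine le_of_mul_le_mul_right ?_ hw1
    nlinarith
  have key := eq_zero_of_abs_deriv_le_mul_abs_self_of_eq_zero_right (f := Y) (f' := Y')
    (K := A + C₂ * (1 + A)) (a := 0) (b := r)
    (fun t ht ↦ (hY t ht).continuousWithinAt)
    (fun t ht ↦ (hY t (Ico_subset_Icc_self ht)).mono_of_mem_nhdsWithin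
      (Icc_mem_nhdsGE_of_mem ht))
    (by simp [Y, p, h0, h0'])
    (by
      intro t ht
      have ht' := Ico_subset_Icc_self ht
      have b1 := bound1 t ht'
      have b2 := hL₂ (c 0 t, c' 0 t) ⟨memK 0 t ht', memK' 0 t ht'⟩ (c 1 t, c' 1 t)
        ⟨memK 1 t ht', memK' 1 t ht'⟩
      have b3 : ‖(c 0 t, c' 0 t) - (c 1 t, c' 1 t)‖ ≤ (1 + A) * ‖Y t‖ := by
        refine max_le ?_ ?_
        · refine (norm_fst_le (Y t)).trans ?_
          nlinarith [norm_nonneg (Y t)]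
        · refine b1.trans ?_
          nlinarith [norm_nonneg (Y t)]
      refine max_le ?_ ?_
      · refine b1.trans ?_
        have : 0 ≤ C₂ * (1 + A) * ‖Y t‖ := by positivity
        linarith
      · refine b2.trans ?_
        have := mul_le_mul_of_nonneg_left b3 hC₂
        have : 0 ≤ A * ‖Y t‖ := by positivity
        linarith)
  intro t ht
  exact sub_eq_zero.1 (congrArg Prod.fst (key t ht))

end EulerLagrange

/-! ### The Riemannian metric in a chart, and energy against distance -/

section ChartMetric

open MeasureTheory Filter Topology
open scoped ENNReal

set_option maxSynthPendingDepth 3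

variable {E : Type*} [NormedAddCommGroup E] [NormedSpace ℝ E]
  {M : Type*} [MetricSpace M] [ChartedSpace E M]

/-- The derivative of the inverse of the chart at `p`. -/
noncomputable def chartDeriv (p : M) (u : E) :
    E →L[ℝ] TangentSpace 𝓘(ℝ, E) ((extChartAt 𝓘(ℝ, E) p).symm u) :=
  mfderivWithin 𝓘(ℝ, E) 𝓘(ℝ, E) (extChartAt 𝓘(ℝ, E) p).symm (extChartAt 𝓘(ℝ, E) p).target u

lemma isOpen_chart_target (p : M) : IsOpen (extChartAt 𝓘(ℝ, E) p).target :=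
  isOpen_extChartAt_target p

/-- The derivatives within the range of the model and within the chart target agree, both sets being
open. -/
lemma chartDeriv_injective [IsManifold 𝓘(ℝ, E) ∞ M] (p : M) {u : E}
    (hu : u ∈ (extChartAt 𝓘(ℝ, E) p).target) : Function.Injective (chartDeriv p u) := by
  have : IsManifold 𝓘(ℝ, E) 1 M := IsManifold.of_le (n := ∞) (by simp)
  have h1 := (isInvertible_mfderivWithin_extChartAt_symm (I := 𝓘(ℝ, E)) hu).injective
  have h2 : mfderivWithin 𝓘(ℝ, E) 𝓘(ℝ, E) (extChartAt 𝓘(ℝ, E) p).symm (range 𝓘(ℝ, E)) u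
      = mfderivWithin 𝓘(ℝ, E) 𝓘(ℝ, E) (extChartAt 𝓘(ℝ, E) p).symm
        (extChartAt 𝓘(ℝ, E) p).target u := by
    rw [mfderivWithin_of_isOpen (isOpen_chart_target p) hu,
      mfderivWithin_of_isOpen (by simp) (by simp)]
  rw [h2] at h1
  exact h1

/-- The velocity of a curve given in the chart. -/
lemma mfderivWithin_chart_symm_comp [IsManifold 𝓘(ℝ, E) ∞ M] (p : M) {r : ℝ} (hr : 0 < r)
    {c : ℝ → E} {v : E} {t : ℝ} (ht : t ∈ Icc (0 : ℝ) r)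
    (hc : HasDerivWithinAt c v (Icc 0 r) t)
    (hcU : ∀ t ∈ Icc (0 : ℝ) r, c t ∈ (extChartAt 𝓘(ℝ, E) p).target) :
    (mfderivWithin 𝓘(ℝ, ℝ) 𝓘(ℝ, E) ((extChartAt 𝓘(ℝ, E) p).symm ∘ c) (Icc 0 r) t (1 : ℝ) :
      TangentSpace 𝓘(ℝ, E) ((extChartAt 𝓘(ℝ, E) p).symm (c t))) = chartDeriv p (c t) v := by
  have h1 : MDifferentiableWithinAt 𝓘(ℝ, E) 𝓘(ℝ, E) (extChartAt 𝓘(ℝ, E) p).symm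
      (extChartAt 𝓘(ℝ, E) p).target (c t) :=
    (contMDiffOn_extChartAt_symm (n := ∞) p).mdifferentiableOn (by simp) _ (hcU t ht)
  have hsub : Icc (0 : ℝ) r ⊆ c ⁻¹' (extChartAt 𝓘(ℝ, E) p).target := hcU
  have h2 := (h1.hasMFDerivWithinAt.comp t hc.hasFDerivWithinAt.hasMFDerivWithinAt
    hsub).mfderivWithin (uniqueMDiffWithinAt_Icc hr ht)
  rw [h2]
  have h3 : (ContinuousLinearMap.toSpanSingleton ℝ v) (1 : ℝ) = v := by simp
  exact congrArg (chartDeriv p (c t)) h3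

variable [RiemannianBundle (fun x : M ↦ TangentSpace 𝓘(ℝ, E) x)]

/-- The Riemannian metric read in the chart at `p`. -/
noncomputable def chartMetric (p : M) (u : E) : E →L[ℝ] E →L[ℝ] ℝ :=
  (innerSL ℝ (E := TangentSpace 𝓘(ℝ, E) ((extChartAt 𝓘(ℝ, E) p).symm u))).bilinearComp
    (chartDeriv p u) (chartDeriv p u)

lemma chartMetric_apply (p : M) (u v w : E) :
    chartMetric p u v w = inner ℝ (chartDeriv p u v) (chartDeriv p u w) := rfl

lemma chartMetric_self (p : M) (u v : E) :
    chartMetric p u v v = ‖chartDeriv p u v‖ ^ 2 := by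
  rw [chartMetric_apply, real_inner_self_eq_norm_sq]

lemma chartMetric_pos [IsManifold 𝓘(ℝ, E) ∞ M] (p : M) {u : E}
    (hu : u ∈ (extChartAt 𝓘(ℝ, E) p).target) {v : E} (hv : v ≠ 0) : 0 < chartMetric p u v v := by
  rw [chartMetric_self]
  have : chartDeriv p u v ≠ 0 := fun h ↦
    hv (chartDeriv_injective p hu (h.trans (map_zero (chartDeriv p u)).symm))
  exact pow_pos (norm_pos_iff.2 this) 2

/-- In finite dimension it suffices to check each entry for fixed `v`, `w`; this is the inner
product of two smooth sections along the inverse chart, the images of constant fields. -/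
lemma contDiffOn_chartMetric [FiniteDimensional ℝ E] [IsManifold 𝓘(ℝ, E) ∞ M]
    [IsContMDiffRiemannianBundle 𝓘(ℝ, E) ∞ E (fun x : M ↦ TangentSpace 𝓘(ℝ, E) x)] (p : M) :
    ContDiffOn ℝ ∞ (chartMetric (E := E) p) (extChartAt 𝓘(ℝ, E) p).target := by
  set U := (extChartAt 𝓘(ℝ, E) p).target with hU
  have hUo : IsOpen U := isOpen_chart_target p
  have hsec : ∀ v : E, ContMDiffOn 𝓘(ℝ, E) (𝓘(ℝ, E).tangent) ∞
      (fun u ↦ (⟨(extChartAt 𝓘(ℝ, E) p).symm u, chartDeriv p u v⟩ : TangentBundle 𝓘(ℝ, E) M))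
      U := by
    intro v
    have h1 : ContMDiffOn 𝓘(ℝ, E) 𝓘(ℝ, E) ∞ (extChartAt 𝓘(ℝ, E) p).symm U :=
      contMDiffOn_extChartAt_symm p
    have h2 := h1.contMDiffOn_tangentMapWithin (m := ∞) (by simp) hUo.uniqueMDiffOn
    have h3 : ContMDiffOn 𝓘(ℝ, E) (𝓘(ℝ, E).tangent) ∞
        (fun u : E ↦ (⟨u, v⟩ : TangentBundle 𝓘(ℝ, E) E)) U := by
      have := (contMDiffOn_vectorSpace_iff_contDiffOn (𝕜 := ℝ) (n := ∞) (s := U)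
        (V := fun _ : E ↦ v)).2 contDiffOn_const
      exact this
    exact h2.comp h3 (fun u hu ↦ hu)
  rw [contDiffOn_clm_apply]
  intro v
  rw [contDiffOn_clm_apply]
  intro w
  rw [← contMDiffOn_iff_contDiffOn]
  exact ContMDiffOn.inner_bundle (E := fun x : M ↦ TangentSpace 𝓘(ℝ, E) x)
    (b := fun u ↦ (extChartAt 𝓘(ℝ, E) p).symm u) (v := fun u ↦ chartDeriv p u v)
    (w := fun u ↦ chartDeriv p u w) (hsec v) (hsec w)

/-- Distance and energy of a curve in a chart. -/
lemma dist_le_energy [FiniteDimensional ℝ E] [IsManifold 𝓘(ℝ, E) ∞ M]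
    [IsContMDiffRiemannianBundle 𝓘(ℝ, E) ∞ E (fun x : M ↦ TangentSpace 𝓘(ℝ, E) x)]
    [IsRiemannianManifold 𝓘(ℝ, E) M] (p : M) {r k : ℝ} (hr : 0 < r) (hk : 0 < k) {c c' : ℝ → E}
    (hc : ∀ t ∈ Icc (0 : ℝ) r, HasDerivWithinAt c (c' t) (Icc 0 r) t)
    (hc' : ContinuousOn c' (Icc 0 r))
    (hcU : ∀ t ∈ Icc (0 : ℝ) r, c t ∈ (extChartAt 𝓘(ℝ, E) p).target) :
    2 * k * dist ((extChartAt 𝓘(ℝ, E) p).symm (c 0)) ((extChartAt 𝓘(ℝ, E) p).symm (c r))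
      ≤ (∫ t in (0 : ℝ)..r, chartMetric p (c t) (c' t) (c' t)) + k ^ 2 * r := by
  set ψ := (extChartAt 𝓘(ℝ, E) p).symm with hψ
  have hud : UniqueDiffOn ℝ (Icc (0 : ℝ) r) := uniqueDiffOn_Icc hr
  have hcc : ContinuousOn c (Icc 0 r) := fun t ht ↦ (hc t ht).continuousWithinAt
  have hc1 : ContDiffOn ℝ 1 c (Icc 0 r) := by
    rw [contDiffOn_one_iff_derivWithin hud]
    refine ⟨fun t ht ↦ (hc t ht).differentiableWithinAt, hc'.congr fun t ht ↦ ?_⟩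
    exact (hc t ht).derivWithin (hud t ht)
  have hγ : ContMDiffOn 𝓘(ℝ, ℝ) 𝓘(ℝ, E) 1 (ψ ∘ c) (Icc 0 r) :=
    ((contMDiffOn_extChartAt_symm (n := ∞) p).of_le (by simp)).comp
      (contMDiffOn_iff_contDiffOn.2 hc1) hcU
  have hLc : ContinuousOn (fun t ↦ chartMetric p (c t) (c' t) (c' t)) (Icc 0 r) :=
    ((((contDiffOn_chartMetric p).continuousOn).comp hcc hcU).clm_apply hc').clm_apply hc'
  -- AM-GM bound for the speed, `‖v‖ ≤ (‖v‖² + k²) / (2k)`, with equality at speed `k`.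
  let b : ℝ → ℝ := fun t ↦ (chartMetric p (c t) (c' t) (c' t) + k ^ 2) / (2 * k)
  have hbc : ContinuousOn b (Icc 0 r) := (hLc.add continuousOn_const).div_const _
  have hb0 : ∀ t, 0 ≤ b t := fun t ↦ by
    simp only [b, chartMetric_self]
    positivity
  have h1 : edist (ψ (c 0)) (ψ (c r)) ≤ ∫⁻ t in Icc 0 r, ENNReal.ofReal (b t) := by
    rw [IsRiemannianManifold.out (I := 𝓘(ℝ, E))]
    refine (Manifold.riemannianEDist_le_pathELength hγ rfl rfl hr.le).trans ?_
    rw [Manifold.pathELength_eq_lintegral_mfderivWithin_Icc]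
    refine setLIntegral_mono' measurableSet_Icc fun t ht ↦ ?_
    have h2 := mfderivWithin_chart_symm_comp p hr ht (hc t ht) hcU
    have h3 : ‖(mfderivWithin 𝓘(ℝ, ℝ) 𝓘(ℝ, E) (ψ ∘ c) (Icc 0 r) t (1 : ℝ) :
      TangentSpace 𝓘(ℝ, E) (ψ (c t)))‖ₑ ≤ ENNReal.ofReal (b t) := by
      rw [h2, ← ofReal_norm]
      refine ENNReal.ofReal_le_ofReal ?_
      simp only [b, chartMetric_self]
      rw [le_div_iff₀ (by positivity)]
      nlinarith [sq_nonneg (‖chartDeriv p (c t) (c' t)‖ - k)]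
    exact h3
  have hbi : Integrable b (volume.restrict (Icc 0 r)) := hbc.integrableOn_Icc
  rw [← ofReal_integral_eq_lintegral_ofReal hbi (ae_of_all _ hb0), edist_dist,
    ENNReal.ofReal_le_ofReal_iff (integral_nonneg hb0), integral_Icc_eq_integral_Ioc,
    ← intervalIntegral.integral_of_le hr.le] at h1
  have h4 : ∫ t in (0 : ℝ)..r, b t
      = ((∫ t in (0 : ℝ)..r, chartMetric p (c t) (c' t) (c' t)) + k ^ 2 * r) / (2 * k) := by
    simp only [b]
    rw [intervalIntegral.integral_div, intervalIntegral.integral_add, intervalIntegral.integral_const]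
    · simp [mul_comm]
    · exact ContinuousOn.intervalIntegrable (by rwa [uIcc_of_le hr.le])
    · simp
  rw [h4, le_div_iff₀ (by positivity)] at h1
  linarith

end ChartMetric

/-! ### Geodesics are determined by their initial velocity -/

section Uniqueness

open MeasureTheory Filter Topology

set_option maxSynthPendingDepth 3

variable {E : Type*} [NormedAddCommGroup E] [NormedSpace ℝ E]
  {M : Type*} [MetricSpace M] [ChartedSpace E M]

/-- Velocities are taken within `[0, 1]` while the chart arguments live on `[0, r]`; the derivatives
agree even at the end points. -/
lemma mfderivWithin_Icc_mono {γ : ℝ → M} (hγ : MDifferentiableOn 𝓘(ℝ, ℝ) 𝓘(ℝ, E) γ (Icc 0 1))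
    {r t : ℝ} (hr : 0 < r) (hr1 : r ≤ 1) (ht : t ∈ Icc 0 r) :
    mfderivWithin 𝓘(ℝ, ℝ) 𝓘(ℝ, E) γ (Icc 0 r) t = mfderivWithin 𝓘(ℝ, ℝ) 𝓘(ℝ, E) γ (Icc 0 1) t :=
  (hγ t ⟨ht.1, ht.2.trans hr1⟩).mfderivWithin_mono (uniqueMDiffWithinAt_Icc hr ht)
    (Icc_subset_Icc_right hr1)

/-- Curves agreeing on `[0, r]` have the same velocity there. -/
lemma velocity_eq_of_eqOn {γ γ' : ℝ → M} (hγ : MDifferentiableOn 𝓘(ℝ, ℝ) 𝓘(ℝ, E) γ (Icc 0 1))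
    (hγ' : MDifferentiableOn 𝓘(ℝ, ℝ) 𝓘(ℝ, E) γ' (Icc 0 1))
    {r t : ℝ} (hr : 0 < r) (hr1 : r ≤ 1) (h : EqOn γ γ' (Icc 0 r)) (ht : t ∈ Icc 0 r) :
    velocity E γ t = velocity E γ' t := by
  have h1 : mfderivWithin 𝓘(ℝ, ℝ) 𝓘(ℝ, E) γ (Icc (0 : ℝ) r) t
      = mfderivWithin 𝓘(ℝ, ℝ) 𝓘(ℝ, E) γ' (Icc (0 : ℝ) r) t := mfderivWithin_congr h (h ht)
  rw [mfderivWithin_Icc_mono hγ hr hr1 ht, mfderivWithin_Icc_mono hγ' hr hr1 ht] at h1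
  unfold velocity
  rw [h1]
  congr 1
  exact h ht

/-- The derivative of a curve read in a chart is a function of its velocity. -/
lemma hasDerivWithinAt_chart_comp [IsManifold 𝓘(ℝ, E) ∞ M] (p : M) {γ : ℝ → M}
    (hγ : MDifferentiableOn 𝓘(ℝ, ℝ) 𝓘(ℝ, E) γ (Icc 0 1)) {r t : ℝ} (hr1 : r ≤ 1)
    (ht : t ∈ Icc 0 r) (hs : γ t ∈ (extChartAt 𝓘(ℝ, E) p).source) :
    HasDerivWithinAt (extChartAt 𝓘(ℝ, E) p ∘ γ)
      (mfderiv 𝓘(ℝ, E) 𝓘(ℝ, E) (extChartAt 𝓘(ℝ, E) p) (velocity E γ t).1 (velocity E γ t).2)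
      (Icc 0 r) t := by
  have : IsManifold 𝓘(ℝ, E) 1 M := IsManifold.of_le (n := ∞) (by simp)
  have h1 : MDifferentiableAt 𝓘(ℝ, E) 𝓘(ℝ, E) (extChartAt 𝓘(ℝ, E) p) (γ t) :=
    mdifferentiableAt_extChartAt (by rwa [extChartAt_source] at hs)
  have h2 := ((hγ t ⟨ht.1, ht.2.trans hr1⟩).hasMFDerivWithinAt).mono (Icc_subset_Icc_right hr1)
  have h3 := h1.hasMFDerivAt.comp_hasMFDerivWithinAt t h2
  obtain ⟨A, hA, hA1⟩ : ∃ A : ℝ →L[ℝ] E,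
      HasFDerivWithinAt (extChartAt 𝓘(ℝ, E) p ∘ γ) A (Icc 0 r) t ∧
      A 1 = mfderiv 𝓘(ℝ, E) 𝓘(ℝ, E) (extChartAt 𝓘(ℝ, E) p) (velocity E γ t).1
        (velocity E γ t).2 := ⟨_, h3.hasFDerivWithinAt, rfl⟩
  exact hA1 ▸ hA.hasDerivWithinAt

variable [RiemannianBundle (fun x : M ↦ TangentSpace 𝓘(ℝ, E) x)]

/-- Two geodesics with the same initial velocity agree for a short time. -/
lemma IsGeodesic.exists_eqOn [FiniteDimensional ℝ E] [IsManifold 𝓘(ℝ, E) ∞ M]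
    [IsContMDiffRiemannianBundle 𝓘(ℝ, E) ∞ E (fun x : M ↦ TangentSpace 𝓘(ℝ, E) x)]
    [IsRiemannianManifold 𝓘(ℝ, E) M] {g : Fin 2 → ℝ → M} (hg : ∀ i, IsGeodesic E (g i))
    (hv : ∀ i, velocity E (g i) 0 = velocity E (g 0) 0) :
    ∃ r > 0, r ≤ 1 ∧ EqOn (g 0) (g 1) (Icc 0 r) := by
  set p := g 0 0 with hp
  have hgp : ∀ i, g i 0 = p := fun i ↦ congrArg TotalSpace.proj (hv i)
  set k := ‖velocityVector E (g 0) 0‖ with hk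
  have hk' : ∀ i, ‖velocityVector E (g i) 0‖ = k := fun i ↦
    congrArg (fun q : TangentBundle 𝓘(ℝ, E) M ↦ ‖q.2‖) (hv i)
  have hd := fun i ↦ (hg i).exists_dist_eq
  choose ε hε hdist using hd
  have hsrc : ∀ i, ∃ ρ > 0, ∀ t ∈ Icc (0 : ℝ) 1, t < ρ →
      g i t ∈ (extChartAt 𝓘(ℝ, E) p).source := by
    intro i
    have h1 : ContinuousWithinAt (g i) (Icc 0 1) 0 := (hg i).smooth.continuousOn 0 (by simp)
    have h2 : (extChartAt 𝓘(ℝ, E) p).source ∈ 𝓝 (g i 0) := by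
      rw [hgp i]; exact extChartAt_source_mem_nhds p
    obtain ⟨ρ, hρ, hsub⟩ := Metric.mem_nhdsWithin_iff.1 (h1 h2)
    refine ⟨ρ, hρ, fun t ht htρ ↦ hsub ⟨?_, ht⟩⟩
    rw [Metric.mem_ball, Real.dist_eq, sub_zero, abs_of_nonneg ht.1]
    exact htρ
  choose ρ hρ hsrc using hsrc
  obtain ⟨r, hr, hr1, hrε, hrρ⟩ : ∃ r > 0, r ≤ 1 ∧ (∀ i, r < ε i) ∧ ∀ i, r < ρ i := by
    have h1 : 0 < min (min (ε 0) (ε 1)) (min (ρ 0) (ρ 1)) :=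
      lt_min (lt_min (hε 0) (hε 1)) (lt_min (hρ 0) (hρ 1))
    obtain ⟨r, hr0, hr⟩ := exists_between (lt_min one_pos h1)
    simp only [lt_min_iff] at hr
    refine ⟨r, hr0, hr.1.le, fun i ↦ ?_, fun i ↦ ?_⟩
    · fin_cases i
      exacts [hr.2.1.1, hr.2.1.2]
    · fin_cases i
      exacts [hr.2.2.1, hr.2.2.2]
  refine ⟨r, hr, hr1, ?_⟩
  have h01 : ∀ {t}, t ∈ Icc 0 r → t ∈ Icc (0 : ℝ) 1 := fun ht ↦ ⟨ht.1, ht.2.trans hr1⟩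
  have hdist' : ∀ i, ∀ t ∈ Icc 0 r, dist p (g i t) = k * t := by
    intro i t ht
    have := hdist i 0 (by simp) t (h01 ht) (by
      rw [zero_sub, abs_neg, abs_of_nonneg ht.1]; exact ht.2.trans_lt (hrε i))
    rwa [hk' i, hgp i, zero_sub, abs_neg, abs_of_nonneg ht.1] at this
  -- At zero speed both curves stay at `p`; the energy comparison below needs `k > 0`.
  rcases (norm_nonneg (velocityVector E (g 0) 0)).eq_or_lt with h0 | hkpos
  · intro t ht
    have h1 := hdist' 0 t ht
    have h2 := hdist' 1 t ht
    rw [hk, ← h0, zero_mul, dist_eq_zero] at h1 h2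
    rw [← h1, ← h2]
  rw [← hk] at hkpos
  set φ := extChartAt 𝓘(ℝ, E) p with hφ
  have hud : UniqueDiffOn ℝ (Icc (0 : ℝ) r) := uniqueDiffOn_Icc hr
  have hsrc' : ∀ i, ∀ t ∈ Icc 0 r, g i t ∈ φ.source := fun i t ht ↦
    hsrc i t (h01 ht) (ht.2.trans_lt (hrρ i))
  let c : Fin 2 → ℝ → E := fun i ↦ φ ∘ g i
  let c' : Fin 2 → ℝ → E := fun i ↦ derivWithin (c i) (Icc 0 r)
  have hcU : ∀ i, ∀ t ∈ Icc 0 r, c i t ∈ φ.target := fun i t ht ↦ φ.map_source (hsrc' i t ht)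
  have hcs : ∀ i, ContDiffOn ℝ ∞ (c i) (Icc 0 r) := by
    intro i
    rw [← contMDiffOn_iff_contDiffOn]
    refine (contMDiffOn_extChartAt (I := 𝓘(ℝ, E)) (x := p)).comp
      ((hg i).smooth.mono (Icc_subset_Icc_right hr1)) fun t ht ↦ ?_
    have := hsrc' i t ht
    rwa [hφ, extChartAt_source] at this
  have hcs' : ∀ i, ContDiffOn ℝ ∞ (c' i) (Icc 0 r) := fun i ↦ (hcs i).derivWithin hud (by simp)
  have hcd : ∀ i, ∀ t ∈ Icc 0 r, HasDerivWithinAt (c i) (c' i t) (Icc 0 r) t := fun i t ht ↦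
    ((hcs i).differentiableOn (by simp) t ht).hasDerivWithinAt
  have hψ : ∀ i, EqOn (φ.symm ∘ c i) (g i) (Icc 0 r) := fun i t ht ↦ φ.left_inv (hsrc' i t ht)
  have hspeed : ∀ i, ∀ t ∈ Icc 0 r, chartMetric p (c i t) (c' i t) (c' i t) = k ^ 2 := by
    intro i t ht
    rw [chartMetric_self]
    congr 1
    have h1 := mfderivWithin_chart_symm_comp p hr ht (hcd i t ht) (hcU i)
    have h2 : mfderivWithin 𝓘(ℝ, ℝ) 𝓘(ℝ, E) (φ.symm ∘ c i) (Icc (0 : ℝ) r) t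
        = mfderivWithin 𝓘(ℝ, ℝ) 𝓘(ℝ, E) (g i) (Icc (0 : ℝ) r) t :=
      mfderivWithin_congr (hψ i) (hψ i ht)
    rw [mfderivWithin_Icc_mono (hg i).mdifferentiableOn hr hr1 ht] at h2
    have h3 : (⟨φ.symm (c i t), chartDeriv p (c i t) (c' i t)⟩ : TangentBundle 𝓘(ℝ, E) M)
        = ⟨g i t, velocityVector E (g i) t⟩ := by
      rw [← h1]
      unfold velocityVector
      rw [← h2]
      congr 1
      exact hψ i ht
    have h4 := congrArg (fun q : TangentBundle 𝓘(ℝ, E) M ↦ ‖q.2‖) h3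
    exact h4.trans (((hg i).norm_velocity (h01 ht)).trans (hk' i))
  have hEL := fun i (t : ℝ) (ht : t ∈ Icc 0 r) (e : E) ↦
    eulerLagrange hr (isOpen_chart_target p) (contDiffOn_chartMetric p)
      (fun u _ v w ↦ by simp only [chartMetric_apply]; exact real_inner_comm _ _)
      (hcs i) (hcs' i) (hcU i) (by
        intro h h' hh' hh h0 hhr
        obtain ⟨ε₀, hε₀, hmem⟩ := exists_forall_add_smul_mem (isOpen_chart_target p)
          (hcs i).continuousOn (hcU i) (fun t ht ↦ (hh t ht).continuousWithinAt)
        filter_upwards [Metric.ball_mem_nhds (0 : ℝ) hε₀] with s hs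
        rw [Metric.mem_ball, Real.dist_eq, sub_zero] at hs
        -- The competitor has the same end points, at distance `k r`, so `2k · kr` is at most its
        -- energy plus `k² r`. The geodesic has energy exactly `k² r`, hence it minimizes.
        have h1 := dist_le_energy p hr hkpos (c := fun t ↦ c i t + s • h t)
          (c' := fun t ↦ c' i t + s • h' t)
          (fun t ht ↦ (hcd i t ht).add ((hh t ht).const_smul s))
          ((hcs' i).continuousOn.add (hh'.const_smul s)) (hmem s hs.le)
        have e0 : φ.symm (c i 0 + s • h 0) = p := by
          rw [h0, smul_zero, add_zero]
          exact (hψ i ⟨le_rfl, hr.le⟩).trans (hgp i)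
        have e1 : φ.symm (c i r + s • h r) = g i r := by
          rw [hhr, smul_zero, add_zero]
          exact hψ i ⟨hr.le, le_rfl⟩
        rw [e0, e1, hdist' i r ⟨hr.le, le_rfl⟩] at h1
        have h2 : ∫ t in (0 : ℝ)..r, chartMetric p (c i t) (c' i t) (c' i t) = k ^ 2 * r := by
          have : ∫ t in (0 : ℝ)..r, chartMetric p (c i t) (c' i t) (c' i t)
              = ∫ t in (0 : ℝ)..r, k ^ 2 := by
            refine intervalIntegral.integral_congr fun t ht ↦ ?_
            rw [uIcc_of_le hr.le] at ht
            exact hspeed i t ht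
          rw [this, intervalIntegral.integral_const, smul_eq_mul, sub_zero, mul_comm]
        rw [h2]
        linarith) e ht
  have hc0' : ∀ i, c' i 0 = mfderiv 𝓘(ℝ, E) 𝓘(ℝ, E) φ (velocity E (g 0) 0).1
      (velocity E (g 0) 0).2 := by
    intro i
    have h0 : (0 : ℝ) ∈ Icc 0 r := ⟨le_rfl, hr.le⟩
    have := (hasDerivWithinAt_chart_comp p (hg i).mdifferentiableOn hr1 h0
      (hsrc' i 0 h0)).derivWithin (hud 0 h0)
    rw [hv i] at this
    exact this
  have key := eulerLagrange_unique hr (isOpen_chart_target p) (contDiffOn_chartMetric p)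
    (fun u hu v hv ↦ chartMetric_pos p hu hv) hcd hcs' hcU hEL
    (by simp only [c, Function.comp_apply, hgp]) ((hc0' 0).trans (hc0' 1).symm)
  intro t ht
  rw [← hψ 0 ht, ← hψ 1 ht]
  exact congrArg φ.symm (key ht)

/-- A geodesic is determined by its initial velocity. -/
theorem IsGeodesic.eqOn_of_velocity_eq [FiniteDimensional ℝ E] [IsManifold 𝓘(ℝ, E) ∞ M]
    [IsContMDiffRiemannianBundle 𝓘(ℝ, E) ∞ E (fun x : M ↦ TangentSpace 𝓘(ℝ, E) x)]
    [IsRiemannianManifold 𝓘(ℝ, E) M] {g g' : ℝ → M} (hg : IsGeodesic E g) (hg' : IsGeodesic E g')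
    (hv : velocity E g 0 = velocity E g' 0) : EqOn g g' (Icc 0 1) := by
  -- Times not exceeding any time of disagreement: an intersection of closed half-lines, so closed
  -- without using continuity of the curves.
  let S : Set ℝ := {s | ∀ t ∈ Icc (0 : ℝ) 1, g t ≠ g' t → s ≤ t}
  have hSc : IsClosed S := by
    have : S = ⋂ t ∈ {t | t ∈ Icc (0 : ℝ) 1 ∧ g t ≠ g' t}, Iic t := by
      ext s; simp [S]
    rw [this]
    exact isClosed_biInter fun t _ ↦ isClosed_Iic
  have heq : ∀ s ∈ S, s ∈ Icc (0 : ℝ) 1 → EqOn g g' (Icc 0 s) := by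
    intro s hs hs1
    rcases hs1.1.eq_or_lt with rfl | hpos
    · intro t ht
      have : t = 0 := le_antisymm ht.2 ht.1
      rw [this]
      exact congrArg TotalSpace.proj hv
    have h1 : EqOn g g' (Ico 0 s) := by
      intro t ht
      by_contra hne
      exact absurd (hs t ⟨ht.1, ht.2.le.trans hs1.2⟩ hne) (not_le.2 ht.2)
    exact h1.of_subset_closure (hg.smooth.continuousOn.mono (Icc_subset_Icc_right hs1.2))
      (hg'.smooth.continuousOn.mono (Icc_subset_Icc_right hs1.2)) Ico_subset_Icc_self
      (by rw [closure_Ico hpos.ne])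
  have hS : Icc (0 : ℝ) 1 ⊆ S := by
    refine IsClosed.Icc_subset_of_forall_exists_gt (hSc.inter isClosed_Icc)
      (fun t ht _ ↦ ht.1) ?_
    rintro s ⟨hs, hs0, hs1⟩ y hy
    have hs01 : s ∈ Icc (0 : ℝ) 1 := ⟨hs0, hs1.le⟩
    have hE := heq s hs hs01
    have hvs : velocity E g s = velocity E g' s := by
      rcases hs0.eq_or_lt with rfl | hpos
      · exact hv
      · exact velocity_eq_of_eqOn hg.mdifferentiableOn hg'.mdifferentiableOn hpos hs1.le hE
          ⟨hs0, le_rfl⟩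
    have haff : ∀ u ∈ Icc (0 : ℝ) 1, s + u * (1 - s) ∈ Icc (0 : ℝ) 1 :=
      affine_mem_Icc hs01 (by simp)
    let G : Fin 2 → ℝ → M := ![fun u ↦ g (s + u * (1 - s)), fun u ↦ g' (s + u * (1 - s))]
    have hG : ∀ i, IsGeodesic E (G i) := by
      intro i
      fin_cases i
      exacts [hg.comp_affine haff, hg'.comp_affine haff]
    have hGv : ∀ i, velocity E (G i) 0 = velocity E (G 0) 0 := by
      have h1 : velocity E (G 1) 0 = velocity E (G 0) 0 := by
        change velocity E (fun u ↦ g' (s + u * (1 - s))) 0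
          = velocity E (fun u ↦ g (s + u * (1 - s))) 0
        rw [hg.velocity_comp_affine haff (by simp), hg'.velocity_comp_affine haff (by simp)]
        have e : s + 0 * (1 - s) = s := by ring
        rw [e]
        exact congrArg (fun q : TangentBundle 𝓘(ℝ, E) M ↦
          (⟨q.1, (1 - s) • q.2⟩ : TangentBundle 𝓘(ℝ, E) M)) hvs.symm
      intro i
      fin_cases i
      exacts [rfl, h1]
    obtain ⟨r, hr, hr1, hEq⟩ := IsGeodesic.exists_eqOn hG hGv
    have h1s : 0 < 1 - s := sub_pos.2 hs1
    have hpos : 0 < r * (1 - s) := mul_pos hr h1s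
    -- The tails from `s` are rescaled to `[0, 1]`, so agreement up to `r` there means agreement up
    -- to `s + r * (1 - s)` here.
    refine ⟨min y (s + r * (1 - s)), ?_, lt_min hy (by linarith), min_le_left _ _⟩
    intro t ht hne
    by_contra hlt
    rw [not_le] at hlt
    have hlt' : t < s + r * (1 - s) := hlt.trans_le (min_le_right _ _)
    have hst : s ≤ t := hs t ht hne
    apply hne
    have := hEq (x := (t - s) / (1 - s))
      ⟨div_nonneg (sub_nonneg.2 hst) h1s.le, by rw [div_le_iff₀ h1s]; linarith⟩
    have e : s + (t - s) / (1 - s) * (1 - s) = t := by field_simp; ring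
    change g (s + (t - s) / (1 - s) * (1 - s)) = g' (s + (t - s) / (1 - s) * (1 - s)) at this
    rwa [e] at this
  exact heq 1 (hS (by simp)) (by simp)

/-- The exponential map is single valued. -/
lemma IsExp.unique [FiniteDimensional ℝ E] [IsManifold 𝓘(ℝ, E) ∞ M]
    [IsContMDiffRiemannianBundle 𝓘(ℝ, E) ∞ E (fun x : M ↦ TangentSpace 𝓘(ℝ, E) x)]
    [IsRiemannianManifold 𝓘(ℝ, E) M] {x y y' : M} {v : TangentSpace 𝓘(ℝ, E) x}
    (h : IsExp x v y) (h' : IsExp x v y') : y = y' := by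
  obtain ⟨g, hg, hv, rfl⟩ := h
  obtain ⟨g', hg', hv', rfl⟩ := h'
  exact hg.eqOn_of_velocity_eq hg' (hv.trans hv'.symm) (by simp)

end Uniqueness

/-! ### One iteration: descent and the convexity inequality -/

section Step

set_option maxSynthPendingDepth 3

variable {E : Type*} [NormedAddCommGroup E] [NormedSpace ℝ E] [FiniteDimensional ℝ E]
  {M : Type*} [MetricSpace M] [ChartedSpace E M]
  [RiemannianBundle (fun x : M ↦ TangentSpace 𝓘(ℝ, E) x)]

/-- Descent along the gradient step. -/
lemma IsGeodesicallySmooth.gradient_step (hM : IsUniquelyGeodesic E M) {L γ : ℝ} (hL : 0 < L)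
    {f : M → ℝ} (hf : IsGeodesicallySmooth E L f) {x y : M}
    (h : IsExp x (-(γ • grad E f x)) y) :
    f y ≤ f x - γ * (1 - L * γ / 2) * ‖grad E f x‖ ^ 2 := by
  have h1 := hf.upper_bound x y
  have h2 := h.dist_le
  rw [hM.expInv_eq h, inner_neg_right, inner_smul_right, real_inner_self_eq_norm_sq] at h1
  rw [norm_neg] at h2
  have h3 : dist x y ^ 2 ≤ γ ^ 2 * ‖grad E f x‖ ^ 2 := by
    have := pow_le_pow_left₀ dist_nonneg h2 2
    rwa [norm_smul, mul_pow, Real.norm_eq_abs, sq_abs] at this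
  nlinarith [mul_le_mul_of_nonneg_left h3 (half_pos hL).le]

/-- The convexity inequality at a point of the geodesic from `y` to `z`. -/
lemma IsGeodesicallyStronglyConvex.le_of_isExp_smul [IsManifold 𝓘(ℝ, E) ∞ M]
    [IsContMDiffRiemannianBundle 𝓘(ℝ, E) ∞ E (fun x : M ↦ TangentSpace 𝓘(ℝ, E) x)]
    [IsRiemannianManifold 𝓘(ℝ, E) M] (hM : IsUniquelyGeodesic E M) {μ α : ℝ} (hμ : 0 ≤ μ)
    {f : M → ℝ} (hf : IsGeodesicallyStronglyConvex E μ f) (hα : α ∈ Icc (0 : ℝ) 1) {x y z : M}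
    (h : IsExp y (α • expInv E y z) x) :
    (1 - α) * f x - α * inner ℝ (grad E f x) (expInv E x z) ≤ (1 - α) * f y := by
  obtain ⟨g, hg, rfl, rfl, -⟩ := hM y z
  have h0 : expInv E (g 0) (g 1) = velocityVector E g 0 := by
    simpa using hM.expInv_eq (hg.isExp (s := 0) (s' := 1) (by simp) (by simp))
  -- Single-valuedness of the exponential identifies the given `x` with the point of this geodesic
  -- at time `α`.
  have hx : x = g α := by
    refine IsExp.unique h ?_
    rw [h0]
    simpa using hg.isExp (s := 0) (s' := α) (by simp) hα
  subst hx
  have h1 := hf.lower_bound (g α) (g 0)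
  rw [hM.expInv_eq (hg.isExp (s := α) (s' := 0) hα (by simp)), inner_smul_right] at h1
  rw [hM.expInv_eq (hg.isExp (s := α) (s' := 1) hα (by simp)), inner_smul_right]
  have h2 : 0 ≤ μ / 2 * dist (g α) (g 0) ^ 2 := by positivity
  nlinarith [mul_le_mul_of_nonneg_left h1 (sub_nonneg.2 hα.2),
    mul_nonneg (sub_nonneg.2 hα.2) h2]

end Step

end RiemNesterov

theorem theorem2
    {E : Type*} [NormedAddCommGroup E] [NormedSpace ℝ E] [FiniteDimensional ℝ E]
    {M : Type*} [MetricSpace M] [ChartedSpace E M] [IsManifold 𝓘(ℝ, E) ∞ M]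
    [RiemannianBundle (fun x : M ↦ TangentSpace 𝓘(ℝ, E) x)]
    [IsContMDiffRiemannianBundle 𝓘(ℝ, E) ∞ E (fun x : M ↦ TangentSpace 𝓘(ℝ, E) x)]
    [IsRiemannianManifold 𝓘(ℝ, E) M]
    (hM : RiemNesterov.IsUniquelyGeodesic E M)
    (f : M → ℝ) (L μ : ℝ) (hL : 0 < L) (hμ : 0 ≤ μ)
    (hsmooth : RiemNesterov.IsGeodesicallySmooth E L f)
    (hconvex : RiemNesterov.IsGeodesicallyStronglyConvex E μ f)
    (xs : M) (hxs : ∀ p : M, f xs ≤ f p)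
    (x y z : ℕ → M) (A B α β γ η ξ δ : ℕ → ℝ) (t : ℕ) (Δ : ℝ)
    (hA : 0 < A t) (hB : 0 < B t)
    (hγ : γ (t + 1) ∈ Ioo 0 (2 / L))
    (hΔ : Δ = γ (t + 1) * (1 - L * γ (t + 1) / 2))
    (hδ_pos : 0 < δ (t + 1))
    (hδ : RiemNesterov.IsValidDistortionRate E (x t) (x (t + 1)) (z t) xs (δ (t + 1)))
    (hξ : ξ (t + 1) ∈ Ico (2 * μ * Δ) 1)
    (hξ_eq : ξ (t + 1) * (ξ (t + 1) - 2 * μ * Δ) / (1 - ξ (t + 1))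
      = 4 * Δ / δ (t + 1) * (B t / A t))
    (hA' : A (t + 1) = A t / (1 - ξ (t + 1)))
    (hB' : B (t + 1) = ξ (t + 1) ^ 2 / (1 - ξ (t + 1)) * (A t / (4 * Δ)))
    (hα : α (t + 1) = (ξ (t + 1) - 2 * μ * Δ) / (1 - 2 * μ * Δ))
    (hβ : β (t + 1) = 1 - 2 * μ * Δ * (ξ (t + 1))⁻¹)
    (hη : η (t + 1) = 2 * Δ * (ξ (t + 1))⁻¹)
    (hstep : RiemNesterov.IsNesterovStep E f (α (t + 1)) (β (t + 1)) (γ (t + 1)) (η (t + 1))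
      (y t) (z t) (x (t + 1)) (y (t + 1)) (z (t + 1))) :
    RiemNesterov.potential E f xs (A (t + 1)) (B (t + 1)) (x (t + 1)) (y (t + 1)) (z (t + 1))
        ≤ RiemNesterov.potential E f xs (A t) (B t) (x t) (y t) (z t) ∧
      f (y (t + 1)) - f xs
          + ξ (t + 1) ^ 2 / (4 * Δ) * RiemNesterov.projDist E (x (t + 1)) (z (t + 1)) xs ^ 2
        ≤ (1 - ξ (t + 1)) *
          (f (y t) - f xs + B t / A t * RiemNesterov.projDist E (x t) (z t) xs ^ 2) := by
  have hstep_x := hstep.x_update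
  have hstep_y := hstep.y_update
  have hstep_z := hstep.z_update
  obtain ⟨hγ0, hγ1⟩ := hγ
  obtain ⟨hξμ, hξ1⟩ := hξ
  have hΔ0 : 0 < Δ := by
    rw [lt_div_iff₀ hL] at hγ1
    rw [hΔ]
    exact mul_pos hγ0 (by linarith)
  have hκ0 : 0 ≤ 2 * μ * Δ := by positivity
  have hrhs : 0 < 4 * Δ / δ (t + 1) * (B t / A t) := by positivity
  -- At `ξ = 0` the left side of `hξ_eq` would vanish, whereas its right side is positive.
  have hξ0 : 0 < ξ (t + 1) := by
    refine lt_of_le_of_ne (hκ0.trans hξμ) fun h ↦ ?_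
    rw [← hξ_eq, ← h] at hrhs
    simp at hrhs
  have h1ξ : 0 < 1 - ξ (t + 1) := by linarith
  have h1κ : 0 < 1 - 2 * μ * Δ := by linarith
  have hα01 : α (t + 1) ∈ Icc (0 : ℝ) 1 := by
    rw [hα]
    exact ⟨div_nonneg (by linarith) h1κ.le, (div_le_one h1κ).2 (by linarith)⟩
  have hy' := RiemNesterov.IsGeodesicallySmooth.gradient_step hM hL hsmooth hstep_y
  rw [← hΔ] at hy'
  have hs := hconvex.lower_bound_expInv hM (x (t + 1)) xs
  have hy := hconvex.le_of_isExp_smul hM hμ hα01 hstep_x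
  have hD : ξ (t + 1) * (ξ (t + 1) - 2 * μ * Δ)
      * ‖RiemNesterov.expInv E (x (t + 1)) (z t) - RiemNesterov.expInv E (x (t + 1)) xs‖ ^ 2
      ≤ 4 * Δ * (1 - ξ (t + 1)) * (B t / A t)
        * RiemNesterov.projDist E (x t) (z t) xs ^ 2 := by
    have h1 : ξ (t + 1) * (ξ (t + 1) - 2 * μ * Δ) * δ (t + 1)
        = 4 * Δ * (1 - ξ (t + 1)) * (B t / A t) := by
      rw [div_eq_iff h1ξ.ne'] at hξ_eq
      rw [hξ_eq]
      field_simp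
    rw [← h1, mul_assoc (ξ (t + 1) * (ξ (t + 1) - 2 * μ * Δ))]
    exact mul_le_mul_of_nonneg_left hδ (mul_nonneg hξ0.le (sub_nonneg.2 hξμ))
  have key := RiemNesterov.potential_decrease hμ hΔ0 hξ0 hξ1 hξμ hα hy' hs hy hD
  have hz : RiemNesterov.projDist E (x (t + 1)) (z (t + 1)) xs
      = ‖(1 - 2 * μ * Δ * (ξ (t + 1))⁻¹) • RiemNesterov.expInv E (x (t + 1)) (z t)
        - (2 * Δ * (ξ (t + 1))⁻¹) • RiemNesterov.grad E f (x (t + 1))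
        - RiemNesterov.expInv E (x (t + 1)) xs‖ := by
    unfold RiemNesterov.projDist
    rw [hM.expInv_eq hstep_z, hβ, hη]
  rw [← hz] at key
  -- The potential form is `key` multiplied by `A (t + 1)`, since `B (t + 1) = A (t + 1) * ξ² /
  -- (4Δ)`.
  refine ⟨?_, key⟩
  unfold RiemNesterov.potential
  rw [hA', hB']
  calc A t / (1 - ξ (t + 1)) * (f (y (t + 1)) - f xs)
        + ξ (t + 1) ^ 2 / (1 - ξ (t + 1)) * (A t / (4 * Δ))
          * RiemNesterov.projDist E (x (t + 1)) (z (t + 1)) xs ^ 2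
      = A t / (1 - ξ (t + 1)) * (f (y (t + 1)) - f xs + ξ (t + 1) ^ 2 / (4 * Δ)
          * RiemNesterov.projDist E (x (t + 1)) (z (t + 1)) xs ^ 2) := by
        field_simp
    _ ≤ A t / (1 - ξ (t + 1)) * ((1 - ξ (t + 1)) * (f (y t) - f xs
          + B t / A t * RiemNesterov.projDist E (x t) (z t) xs ^ 2)) :=
        mul_le_mul_of_nonneg_left key (div_nonneg hA.le h1ξ.le)
    _ = A t * (f (y t) - f xs) + B t * RiemNesterov.projDist E (x t) (z t) xs ^ 2 := by
        field_simp
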